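/- Let $k$ be a field and let $H$ be a finite-dimensional Hopf algebra over $k$ with comultiplication $\Delta(h)=\sum h_1\otimes h_2$, counit $\varepsilon$ and antipode $S$; let $H^*$ be the dual Hopf algebra, with convolution product $(f f')(h)=\sum f(h_1)f'(h_2)$, comultiplication determined by $\sum f_1(x)f_2(y)=f(xy)$, counit $f\mapsto f(1)$ and antipode $f\mapsto f\circ S$. Let $\alpha\in H^*$ be the distinguished grouplike element of $H^*$, i.e. the algebra morphism $\alpha:H\to k$ with $th=\alpha(h)t$ for every left integral $t$ in $H$ (an element with $ht=\varepsilon(h)t$ for all $h\in H$) and all $h\in H$; let $g\in H$ be the distinguished grouplike element of $H$, i.e. the grouplike element with $Tf=f(g)T$ for every left integral $T$ on $H$ (an element $T\in H^*$ with $fT=f(1)T$ for all $f\in H^*$) and all $f\in H^*$. **Symmetry.** Let $L$ be a Hopf algebra over $k$ with antipode $S$, and let $u:L\to k$ be a sovereign character, i.e. an algebra morphism with $S^2(h)=\sum u^{-1}(h_1)u(h_3)h_2$ for all $h\in L$, where $u^{-1}=u\circ S$. A finite-dimensional right $L$-comodule algebra $B$, with coaction $b\mapsto\sum b_0\otimes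 b_1$, is called $(L,u)$-symmetric if there is a linear bijection $\theta:B\to B^*$ that is left and right $B$-linear and right $L$-colinear, where $B^*$ carries the right action $(\varphi a)(b)=\varphi(ab)$, the left action $(a*\varphi)(b)=\varphi\big(b\sum u^{-1}(a_1)a_0\big)$, and the right $L$-coaction $\varphi\mapsto\sum\varphi_0\otimes\varphi_1$ determined by $\sum\varphi_0(b)\varphi_1=\sum\varphi(b_0)S(b_1)$ for all $b\in B$. **Smash product.** For a right $H$-comodule algebra $A$, let $H^*$ act on $A$ by $f\cdot a=\sum f(a_1)a_0$. The smash product $A\# H^*$ is the vector space $A\otimes H^*$ with multiplication $(a\# f)(b\# f')=\sum a(f_1\cdot b)\# f_2f'$ and unit $1\#\varepsilon$; it is a right $H^*$-comodule algebra with coaction $a\# f\mapsto\sum (a\# f_1)\otimes f_2$. An element $g\in H$ that is grouplike is regarded as the character $f\mapsto f(g)$ of $H^*$. **Theorem.** Assume that $$S^2(h)=g^{-1}hg=\sum \alpha^{-1}(h_1)\alpha(h_3)h_2\qquad\text{for all } h\in H .$$ Then a finite-dimensional right $H$-comodule algebra $A$ is $(H,\alpha)$-symmetric if and only if the smash product $A\#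 H^*$ is $(H^*,g)$-symmetric. -/

import Mathlib

open scoped TensorProduct
noncomputable section
namespace HopfSmash
open TensorProduct Coalgebra HopfAlgebra
universe u v w
section Dual
variable (k : Type u) (H : Type v) [Field k] [Ring H] [HopfAlgebra k H]

/-- The dual `H*` of `H`, with the convolution product `(f * g)(h) = ∑ f(h₁) g(h₂)` and unit `ε`
(Mathlib's convolution algebra of linear maps `H → k`). -/
def HopfDual : Type (max u v) := WithConv (H →ₗ[k] k)

instance : Ring (HopfDual k H) := inferInstanceAs (Ring (WithConv (H →ₗ[k] k)))

instance : Algebra k (HopfDual k H) := inferInstanceAs (Algebra k (WithConv (H →ₗ[k] k)))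

/-- The identification of `H*` with the space of linear forms on `H`. -/
def toForm : HopfDual k H ≃ₗ[k] (H →ₗ[k] k) where
  toFun f := WithConv.ofConv f
  invFun f := WithConv.toConv f
  map_add' _ _ := rfl
  map_smul' _ _ := rfl
  left_inv _ := rfl
  right_inv _ := rfl

instance : CoeFun (HopfDual k H) (fun _ => H → k) := ⟨fun f => toForm k H f⟩

variable {k H}

@[ext] theorem hopfDual_ext {f g : HopfDual k H} (h : ∀ x, f x = g x) : f = g :=
  (toForm k H).injective (LinearMap.ext h)

@[simp] theorem toForm_symm_apply (f : H →ₗ[k] k) (x : H) : (toForm k H).symm f x = f x := rfl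

theorem hopfDual_mul_apply (f g : HopfDual k H) (x : H) :
    (f * g) x = LinearMap.mul' k k (TensorProduct.map (toForm k H f) (toForm k H g)
      (comul (R := k) x)) := rfl

@[simp] theorem hopfDual_one_apply (x : H) : (1 : HopfDual k H) x = counit (R := k) x := rfl

variable (k) in
/-- Evaluation at an element of `H`, as a linear form on `H*`. -/
def evalAt (x : H) : HopfDual k H →ₗ[k] k :=
  (LinearMap.applyₗ x) ∘ₗ (toForm k H).toLinearMap

@[simp] theorem evalAt_apply (x : H) (f : HopfDual k H) : evalAt k x f = f x := rfl

/-- The right translate `f ↼ x`, that is `y ↦ f (x y)`. -/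
def translate (f : HopfDual k H) : H →ₗ[k] HopfDual k H :=
  (toForm k H).symm.toLinearMap ∘ₗ
    (LinearMap.mul k H).compr₂ (toForm k H f)

@[simp] theorem translate_apply (f : HopfDual k H) (x y : H) : translate f x y = f (x * y) := rfl

variable [Module.Finite k H]

variable (k H) in
/-- The canonical isomorphism `H* ⊗ H* ≃ (H ⊗ H)*`, for `H` finite dimensional. -/
def pairing : HopfDual k H ⊗[k] HopfDual k H ≃ₗ[k] Module.Dual k (H ⊗[k] H) :=
  (TensorProduct.congr (toForm k H)
    (toForm k H)).trans (TensorProduct.dualDistribEquiv k H H)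

@[simp] theorem pairing_tmul (f g : HopfDual k H) (x y : H) :
    pairing k H (f ⊗ₜ g) (x ⊗ₜ y) = f x * g y := rfl

/-- The comultiplication of `H*` is the transpose of the multiplication of `H`, that is
`∑ f₁(x) f₂(y) = f (x y)`, and its counit is `f ↦ f 1`. -/
instance : CoalgebraStruct k (HopfDual k H) where
  comul := (pairing k H).symm.toLinearMap ∘ₗ (LinearMap.mul' k H).dualMap ∘ₗ
    (toForm k H).toLinearMap
  counit := evalAt k 1

theorem pairing_comul (f : HopfDual k H) (x y : H) :
    pairing k H (comul (R := k) f) (x ⊗ₜ y) = f (x * y) := by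
  simp [comul]

@[simp] theorem counit_apply (f : HopfDual k H) : counit (R := k) f = f 1 := rfl

theorem ext_left {M : Type*} [AddCommMonoid M] [Module k M] {s t : HopfDual k H ⊗[k] M}
    (h : ∀ x : H, (evalAt k x).rTensor M s = (evalAt k x).rTensor M t) : s = t := by
  apply ((toForm k H).rTensor M).injective
  apply (dualTensorHom_bijective (R := k) (M := H) (N := M)).1
  ext x
  have key : ∀ r : HopfDual k H ⊗[k] M, dualTensorHom k H M
      ((toForm k H).rTensor M r) x
      = TensorProduct.lid k M ((evalAt k x).rTensor M r) := by
    intro r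
    induction r with
    | zero => simp
    | add a b ha hb => simp only [map_add, LinearMap.add_apply, ha, hb]
    | tmul a b => simp
  rw [key, key, h]

theorem lid_evalAt_comul (f : HopfDual k H) (x : H) :
    TensorProduct.lid k _ ((evalAt k x).rTensor _ (comul (R := k) f)) = translate f x := by
  apply hopfDual_ext
  intro y
  rw [translate_apply, ← pairing_comul]
  generalize comul (R := k) f = r
  induction r with
  | zero => simp
  | add a b ha hb => simp_all
  | tmul a b => simp

theorem evalAt_comul (f : HopfDual k H) (x : H) :
    (evalAt k x).rTensor _ (comul (R := k) f) = 1 ⊗ₜ translate f x := by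
  rw [← lid_evalAt_comul]
  apply (TensorProduct.lid k _).injective
  simp

theorem map_evalAt_comul (f : HopfDual k H) (x y : H) :
    (TensorProduct.lid k k).toLinearMap ∘ₗ TensorProduct.map (evalAt k x) (evalAt k y) ∘ₗ
      comul (R := k) = evalAt k (x * y) := by
  ext f
  have := congrArg (evalAt k y) (lid_evalAt_comul f x)
  simp only [LinearMap.comp_apply, evalAt_apply, translate_apply] at this ⊢
  rw [← this]
  generalize comul (R := k) f = r
  induction r with
  | zero => simp
  | add a b ha hb => simp_all
  | tmul a b => simp

theorem ext_tensor {s t : HopfDual k H ⊗[k] HopfDual k H}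
    (h : ∀ x y, pairing k H s (x ⊗ₜ y) = pairing k H t (x ⊗ₜ y)) : s = t := by
  apply (pairing k H).injective
  exact TensorProduct.ext' h

instance : Coalgebra k (HopfDual k H) where
  coassoc := by
    refine LinearMap.ext fun f => ?_
    apply ext_left; intro x
    apply (TensorProduct.lid k _).injective
    apply ext_tensor; intro y z
    have h1 : ∀ r : HopfDual k H ⊗[k] HopfDual k H,
        pairing k H (TensorProduct.lid k _ ((evalAt k x).rTensor _
          (TensorProduct.assoc k _ _ _ (comul.rTensor _ r)))) (y ⊗ₜ z)
        = pairing k H r ((x * y) ⊗ₜ z) := by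
      intro r
      induction r with
      | zero => simp
      | add a b ha hb => simp only [map_add, LinearMap.add_apply, ha, hb]
      | tmul a b =>
        rw [pairing_tmul, ← pairing_comul a, LinearMap.rTensor_tmul]
        generalize comul (R := k) a = r
        induction r with
        | zero => simp
        | add a b ha hb => simp only [map_add, LinearMap.add_apply, ha, hb, add_mul, TensorProduct.add_tmul]
        | tmul c d => simp [mul_assoc]
    have h2 : ∀ r : HopfDual k H ⊗[k] HopfDual k H,
        pairing k H (TensorProduct.lid k _ ((evalAt k x).rTensor _
          (comul.lTensor _ r))) (y ⊗ₜ z)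
        = pairing k H r (x ⊗ₜ (y * z)) := by
      intro r
      induction r with
      | zero => simp
      | add a b ha hb => simp only [map_add, LinearMap.add_apply, ha, hb]
      | tmul a b => simp [pairing_comul]
    exact (h1 _).trans (Eq.trans (by rw [pairing_comul, pairing_comul, mul_assoc]) (h2 _).symm)
  rTensor_counit_comp_comul := by
    ext f : 1
    change (evalAt k 1).rTensor _ (comul (R := k) f) = 1 ⊗ₜ f
    rw [evalAt_comul]
    congr 1
    apply hopfDual_ext; simp
  lTensor_counit_comp_comul := by
    ext f : 1
    apply ext_left; intro x
    apply (TensorProduct.lid k _).injective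
    have h2 : ∀ r : HopfDual k H ⊗[k] HopfDual k H,
        TensorProduct.lid k _ ((evalAt k x).rTensor _ ((evalAt k 1).lTensor _ r))
        = pairing k H r (x ⊗ₜ 1) := by
      intro r
      induction r with
      | zero => simp
      | add a b ha hb => simp only [map_add, LinearMap.add_apply, ha, hb]
      | tmul a b => simp
    refine (h2 _).trans ?_
    rw [pairing_comul]
    simp

theorem pairing_mul (s t : HopfDual k H ⊗[k] HopfDual k H) (p : H ⊗[k] H) :
    pairing k H (s * t) p =
      LinearMap.mul' k k (TensorProduct.map (pairing k H s) (pairing k H t)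
        (comul (R := k) p)) := by
  induction s with
  | zero => simp
  | add a b ha hb => simp only [map_add, add_mul, TensorProduct.map_add_left, LinearMap.add_apply, ha, hb]
  | tmul a b =>
    induction t with
    | zero => simp
    | add a b ha hb =>
      simp only [map_add, mul_add, TensorProduct.map_add_right, LinearMap.add_apply, ha, hb]
    | tmul c d =>
      induction p with
      | zero => simp
      | add a b ha hb => simp only [map_add, ha, hb]
      | tmul x y =>
        rw [Algebra.TensorProduct.tmul_mul_tmul, pairing_tmul, hopfDual_mul_apply,
          hopfDual_mul_apply, TensorProduct.comul_tmul]
        generalize comul (R := k) x = r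
        generalize comul (R := k) y = r'
        induction r with
        | zero => simp
        | add a b ha hb => simp only [map_add, add_mul, TensorProduct.add_tmul, ha, hb]
        | tmul a' b' =>
          induction r' with
          | zero => simp
          | add a b ha hb => simp only [map_add, mul_add, TensorProduct.tmul_add, ha, hb]
          | tmul c' d' => simp; ring

instance : Bialgebra k (HopfDual k H) :=
  Bialgebra.mk' k _ (by simp) (by intro f g; simp [hopfDual_mul_apply, Algebra.TensorProduct.one_def])
    (by
      apply ext_tensor; intro x y
      rw [pairing_comul, Algebra.TensorProduct.one_def, pairing_tmul]; simp)
    (by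
      intro f g
      apply ext_tensor; intro x y
      have h : ∀ f : HopfDual k H,
          pairing k H (comul (R := k) f) = toForm k H f ∘ₗ LinearMap.mul' k H := fun f =>
        TensorProduct.ext' fun x y => pairing_comul f x y
      rw [pairing_comul, pairing_mul, hopfDual_mul_apply, h, h, TensorProduct.map_comp,
        TensorProduct.comul_tmul, Bialgebra.comul_mul, LinearMap.comp_apply]
      congr 2
      generalize comul (R := k) x = r
      generalize comul (R := k) y = r'
      induction r with
      | zero => simp
      | add a b ha hb => simp only [map_add, add_mul, TensorProduct.add_tmul, ha, hb]
      | tmul a' b' =>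
        induction r' with
        | zero => simp
        | add a b ha hb => simp only [map_add, mul_add, TensorProduct.tmul_add, ha, hb]
        | tmul c' d' => simp)

variable (k H) in
/-- The antipode of `H*`: `f ↦ f ∘ S`. -/
def dualAntipode : HopfDual k H →ₗ[k] HopfDual k H :=
  (toForm k H).symm.toLinearMap ∘ₗ (antipode k (A := H)).dualMap ∘ₗ (toForm k H).toLinearMap

@[simp] theorem dualAntipode_apply (f : HopfDual k H) (x : H) :
    dualAntipode k H f x = f (antipode k x) := rfl

theorem conv_eq_pairing (P Q : HopfDual k H →ₗ[k] HopfDual k H) (p q : H →ₗ[k] H)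
    (hP : ∀ f x, P f x = f (p x)) (hQ : ∀ f x, Q f x = f (q x)) (f : HopfDual k H) (x : H) :
    (LinearMap.mul' k _ (TensorProduct.map P Q (comul (R := k) f))) x =
      f (LinearMap.mul' k H (TensorProduct.map p q (comul (R := k) x))) := by
  have h1 : ∀ r : HopfDual k H ⊗[k] HopfDual k H,
      (LinearMap.mul' k _ (TensorProduct.map P Q r)) x =
        pairing k H r (TensorProduct.map p q (comul (R := k) x)) := by
    intro r
    induction r with
    | zero => simp
    | add a b ha hb => simp only [map_add, LinearMap.add_apply, ha, hb]
    | tmul a b =>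
      rw [TensorProduct.map_tmul, LinearMap.mul'_apply, hopfDual_mul_apply]
      generalize comul (R := k) x = s
      induction s with
      | zero => simp
      | add a b ha hb => simp only [map_add, ha, hb]
      | tmul c d => simp [hP, hQ]
  rw [h1]
  generalize TensorProduct.map p q (comul (R := k) x) = s
  induction s with
  | zero => simp
  | add a b ha hb => simp only [map_add, ha, hb]
  | tmul c d => rw [pairing_comul, LinearMap.mul'_apply]

/-- The dual Hopf algebra of a finite dimensional Hopf algebra. -/
instance : HopfAlgebra k (HopfDual k H) where
  antipode := dualAntipode k H
  mul_antipode_rTensor_comul := by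
    ext f x
    have := conv_eq_pairing (dualAntipode k H) LinearMap.id (antipode k) LinearMap.id
      (fun _ _ => rfl) (fun _ _ => rfl) f x
    refine this.trans ?_
    have h := mul_antipode_rTensor_comul_apply (R := k) x
    rw [LinearMap.rTensor] at h
    rw [h]
    simp [Algebra.algebraMap_eq_smul_one, mul_comm]
  mul_antipode_lTensor_comul := by
    ext f x
    have := conv_eq_pairing LinearMap.id (dualAntipode k H) LinearMap.id (antipode k)
      (fun _ _ => rfl) (fun _ _ => rfl) f x
    refine this.trans ?_
    have h := mul_antipode_lTensor_comul_apply (R := k) x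
    rw [LinearMap.lTensor] at h
    rw [h]
    simp [Algebra.algebraMap_eq_smul_one, mul_comm]
end Dual

section Comodule
variable (k : Type u) (H : Type v) (A : Type w) [Field k] [Ring H] [HopfAlgebra k H]
  [Ring A] [Algebra k A]

/-- A right `H`-comodule algebra: an algebra `A` with a coassociative and counital coaction
`A → A ⊗ H`, `a ↦ ∑ a₀ ⊗ a₁`, that is an algebra morphism. -/
class RightComoduleAlgebra where
  /-- The coaction. -/
  coact : A →ₐ[k] A ⊗[k] H
  coassoc : (TensorProduct.assoc k A H H).toLinearMap ∘ₗ
      coact.toLinearMap.rTensor H ∘ₗ coact.toLinearMap =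
    (comul (R := k) (A := H)).lTensor A ∘ₗ coact.toLinearMap
  counit_coact : (TensorProduct.rid k A).toLinearMap ∘ₗ
    (counit (R := k) (A := H)).lTensor A ∘ₗ coact.toLinearMap = LinearMap.id

open RightComoduleAlgebra

variable [RightComoduleAlgebra k H A]

/-- The coaction `a ↦ ∑ a₀ ⊗ a₁` as a linear map. -/
def coaction : A →ₗ[k] A ⊗[k] H := (coact (k := k) (H := H) (A := A)).toLinearMap

variable {k H A}
/-- The action of a linear form `h` on `H` on a comodule algebra: `h · a = ∑ h(a₁) a₀`. -/
def formAct (h : H →ₗ[k] k) : A →ₗ[k] A :=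
  (TensorProduct.rid k A).toLinearMap ∘ₗ h.lTensor A ∘ₗ coaction k H A

/-- The convolution inverse `u⁻¹ = u ∘ S` of a character `u` of `H`. -/
def charInv (u : H →ₐ[k] k) : H →ₗ[k] k := u.toLinearMap ∘ₗ antipode k

/-- The map `h ↦ ∑ u⁻¹(h₁) u(h₃) h₂`. -/
def sovereignConj (u : H →ₐ[k] k) : H →ₗ[k] H :=
  (TensorProduct.lid k H).toLinearMap ∘ₗ
    TensorProduct.map (charInv u) ((TensorProduct.rid k H).toLinearMap ∘ₗ u.toLinearMap.lTensor H) ∘ₗ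
    (comul (R := k)).lTensor H ∘ₗ comul (R := k)

/-- `u` is a sovereign character of `H`: `S²(h) = ∑ u⁻¹(h₁) u(h₃) h₂` for all `h`. -/
def IsSovereign (u : H →ₐ[k] k) : Prop :=
  ∀ h : H, antipode k (antipode k h) = sovereignConj u h

variable (k H A) in
/-- The coaction on `A*` for `A` finite dimensional. Through the isomorphism
`A* ⊗ H ≃ Hom(A, H)` it sends `φ` to the map `a ↦ ∑ φ(a₀) S(a₁)`; in other words, if the coaction
of `A` is `a ↦ ∑ᵢ aᵢ*(a) aᵢ ⊗ hᵢ`, it sends `φ` to `∑ᵢ φ(aᵢ) aᵢ* ⊗ S(hᵢ)`. -/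
def dualCoaction [Module.Finite k A] : Module.Dual k A →ₗ[k] Module.Dual k A ⊗[k] H :=
  (dualTensorHomEquiv k A H).symm.toLinearMap ∘ₗ
  { toFun := fun φ => antipode k ∘ₗ (TensorProduct.lid k H).toLinearMap ∘ₗ φ.rTensor H ∘ₗ
      coaction k H A
    map_add' := fun φ ψ => by simp [LinearMap.rTensor_add, LinearMap.add_comp, LinearMap.comp_add]
    map_smul' := fun c φ => by simp [LinearMap.rTensor_smul, LinearMap.smul_comp, LinearMap.comp_smul] }

/-- The usual right action of `A` on `A*`: `(φ a)(b) = φ(a b)`. -/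
def dualRightAct (φ : Module.Dual k A) (a : A) : Module.Dual k A := φ ∘ₗ LinearMap.mulLeft k a

/-- The usual left action of `A` on `A*`: `(a φ)(b) = φ(b a)`. -/
def dualLeftAct (a : A) (φ : Module.Dual k A) : Module.Dual k A := φ ∘ₗ LinearMap.mulRight k a

/-- The left action `a * φ = (u⁻¹ · a) φ` of `A` on `F(A*)`, the usual left action on `A*` deformed
by the character `u`. -/
def twistedLeftAct (u : H →ₐ[k] k) (a : A) (φ : Module.Dual k A) : Module.Dual k A :=
  dualLeftAct (formAct (charInv u) a) φ

variable (A) in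
/-- The finite dimensional right `H`-comodule algebra `A` is `(H, u)`-symmetric: `u` is a sovereign
character of `H`, and there is an isomorphism `θ` from `A` to `F(A*)` in the category of
`A`-`A`-bimodules in right `H`-comodules, that is, a linear bijection that is left and right
`A`-linear and `H`-colinear. Here `F(A*)` is `A*` with the `u`-deformed left action, the usual
right action and the dual coaction. -/
def IsSymmetric [Module.Finite k A] (u : H →ₐ[k] k) : Prop :=
  IsSovereign u ∧ ∃ θ : A ≃ₗ[k] Module.Dual k A,
    (∀ a x : A, θ (a * x) = twistedLeftAct u a (θ x)) ∧
    (∀ x a : A, θ (x * a) = dualRightAct (θ x) a) ∧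
    (∀ x : A, dualCoaction k H A (θ x) = θ.toLinearMap.rTensor H (coaction k H A x))

section Smash
variable (k H A) in
/-- The left action of `H*` on `A`: `f · a = ∑ f(a₁) a₀`. -/
def dualAct : HopfDual k H →ₗ[k] A →ₗ[k] A where
  toFun h := formAct (toForm k H h)
  map_add' h h' := by
    simp [formAct, LinearMap.lTensor_add, LinearMap.add_comp, LinearMap.comp_add]
  map_smul' c h := by
    simp [formAct, LinearMap.lTensor_smul, LinearMap.smul_comp, LinearMap.comp_smul]

variable [Module.Finite k H]

variable (k H A) in
/-- The map `H* ⊗ A → A ⊗ H*`, `f ⊗ b ↦ ∑ (f₁ · b) ⊗ f₂`. -/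
def braid : HopfDual k H ⊗[k] A →ₗ[k] A ⊗[k] HopfDual k H :=
  (TensorProduct.lift (dualAct k H A)).rTensor (HopfDual k H) ∘ₗ
    (TensorProduct.rightComm k (HopfDual k H) (HopfDual k H) A).toLinearMap ∘ₗ
    (comul (R := k)).rTensor A

variable (k H A) in
/-- The multiplication of the smash product:
`(a ⊗ f) ⊗ (b ⊗ g) ↦ ∑ a (f₁ · b) ⊗ f₂ g`. -/
def smashMul : (A ⊗[k] HopfDual k H) ⊗[k] (A ⊗[k] HopfDual k H) →ₗ[k] A ⊗[k] HopfDual k H :=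
  TensorProduct.map (LinearMap.mul' k A) (LinearMap.mul' k (HopfDual k H)) ∘ₗ
    (TensorProduct.assoc k A A (HopfDual k H ⊗[k] HopfDual k H)).symm.toLinearMap ∘ₗ
    ((TensorProduct.assoc k A (HopfDual k H) (HopfDual k H)).toLinearMap ∘ₗ
      (braid k H A).rTensor (HopfDual k H) ∘ₗ
      (TensorProduct.assoc k (HopfDual k H) A (HopfDual k H)).symm.toLinearMap).lTensor A ∘ₗ
    (TensorProduct.assoc k A (HopfDual k H) (A ⊗[k] HopfDual k H)).toLinearMap

theorem ext_right {M : Type*} [AddCommMonoid M] [Module k M] {s t : M ⊗[k] HopfDual k H}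
    (h : ∀ x : H, TensorProduct.rid k M ((evalAt k x).lTensor M s) =
      TensorProduct.rid k M ((evalAt k x).lTensor M t)) : s = t := by
  apply (TensorProduct.comm k _ _).injective
  apply ext_left
  intro x
  have := congrArg (TensorProduct.comm k _ _) ((TensorProduct.rid k M).injective (h x))
  rw [← LinearMap.comm_comp_lTensor_comp_comm_eq]
  simpa using this

theorem braid_tmul (h : HopfDual k H) (b : A) :
    braid k H A (h ⊗ₜ b) = (translate h).lTensor A (coaction k H A b) := by
  apply ext_right
  intro y
  have key : ∀ r : HopfDual k H ⊗[k] HopfDual k H,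
      TensorProduct.rid k A ((evalAt k y).lTensor A
        ((TensorProduct.lift (dualAct k H A)).rTensor (HopfDual k H)
          (TensorProduct.rightComm k _ _ _ (r ⊗ₜ b)))) =
      TensorProduct.rid k A ((pairing k H r ∘ₗ (TensorProduct.mk k H H).flip y).lTensor A
        (coaction k H A b)) := by
    intro r
    induction r with
    | zero => simp
    | add r r' hr hr' =>
      simp only [TensorProduct.add_tmul, map_add, hr, hr', LinearMap.add_comp,
        LinearMap.lTensor_add, LinearMap.add_apply]
    | tmul h₁ h₂ =>
      simp only [TensorProduct.rightComm_tmul, LinearMap.rTensor_tmul, TensorProduct.lift.tmul,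
        LinearMap.lTensor_tmul, TensorProduct.rid_tmul, dualAct, formAct, LinearMap.coe_mk,
        AddHom.coe_mk, LinearMap.comp_apply, LinearEquiv.coe_coe, evalAt_apply]
      generalize coaction k H A b = s
      induction s with
      | zero => simp
      | add s s' hs hs' => simp only [map_add, smul_add, hs, hs']
      | tmul c d => simp [smul_smul, mul_comm]
  refine (key _).trans ?_
  rw [← LinearMap.lTensor_comp_apply]
  congr 3
  ext x
  simp [pairing_comul]

theorem smashMul_tmul (a b : A) (h g : HopfDual k H) :
    smashMul k H A ((a ⊗ₜ h) ⊗ₜ (b ⊗ₜ g)) =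
      TensorProduct.map (LinearMap.mulLeft k a) (LinearMap.mulRight k g ∘ₗ translate h)
        (coaction k H A b) := by
  simp only [smashMul, LinearMap.comp_apply, LinearEquiv.coe_coe, TensorProduct.assoc_tmul,
    LinearMap.lTensor_tmul, TensorProduct.assoc_symm_tmul, LinearMap.rTensor_tmul, braid_tmul]
  generalize coaction k H A b = s
  induction s with
  | zero => simp
  | add s s' hs hs' => simp only [map_add, TensorProduct.add_tmul, TensorProduct.tmul_add, hs, hs']
  | tmul c d => simp

theorem translate_mul (f g : HopfDual k H) (y : H) :
    translate (f * g) y = LinearMap.mul' k _ (TensorProduct.map (translate f) (translate g)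
      (comul (R := k) y)) := by
  ext z
  rw [translate_apply, hopfDual_mul_apply, Bialgebra.comul_mul]
  generalize comul (R := k) y = r
  induction r with
  | zero => simp
  | add a b ha hb => simp only [map_add, add_mul, LinearMap.add_apply, ha, hb]
  | tmul a b =>
    simp only [TensorProduct.map_tmul, LinearMap.mul'_apply, hopfDual_mul_apply]
    generalize comul (R := k) z = s
    induction s with
    | zero => simp
    | add a b ha hb => simp only [map_add, mul_add, ha, hb]
    | tmul c d => simp

@[simp] theorem translate_one (f : HopfDual k H) : translate f 1 = f := by
  ext z; simp

theorem translate_translate (f : HopfDual k H) (x y : H) :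
    translate (translate f x) y = translate f (x * y) := by
  ext z; simp [mul_assoc]

theorem coaction_mul (a b : A) :
    coaction k H A (a * b) = coaction k H A a * coaction k H A b := map_mul coact a b

theorem coaction_one : coaction k H A 1 = 1 ⊗ₜ 1 := map_one coact

theorem smash_one_mul (z : A ⊗[k] HopfDual k H) : smashMul k H A ((1 ⊗ₜ 1) ⊗ₜ z) = z := by
  induction z with
  | zero => simp
  | add a b ha hb => rw [TensorProduct.tmul_add, map_add, ha, hb]
  | tmul b g =>
    rw [smashMul_tmul]
    have h := LinearMap.congr_fun (counit_coact (k := k) (H := H) (A := A)) b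
    have h' : ∀ s : A ⊗[k] H, TensorProduct.map (LinearMap.mulLeft k (1 : A))
        (LinearMap.mulRight k g ∘ₗ translate 1) s =
        (TensorProduct.rid k A ((counit (R := k) (A := H)).lTensor A s)) ⊗ₜ g := by
      intro s
      induction s with
      | zero => simp
      | add s s' hs hs' => simp only [map_add, TensorProduct.add_tmul, hs, hs']
      | tmul c d =>
        have : translate (k := k) 1 d = (counit (R := k) d) • (1 : HopfDual k H) := by
          ext z; simp
        simp [this, TensorProduct.smul_tmul]
    rw [h']
    exact congrArg (· ⊗ₜ[k] g) h

theorem smash_mul_one (z : A ⊗[k] HopfDual k H) : smashMul k H A (z ⊗ₜ (1 ⊗ₜ 1)) = z := by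
  induction z with
  | zero => simp
  | add a b ha hb => rw [TensorProduct.add_tmul, map_add, ha, hb]
  | tmul b g => rw [smashMul_tmul, coaction_one]; simp

theorem smash_mul_assoc (x y z : A ⊗[k] HopfDual k H) :
    smashMul k H A (smashMul k H A (x ⊗ₜ y) ⊗ₜ z) =
      smashMul k H A (x ⊗ₜ smashMul k H A (y ⊗ₜ z)) := by
  induction x with
  | zero => simp
  | add x x' hx hx' => simp only [TensorProduct.add_tmul, map_add, hx, hx']
  | tmul a h =>
  induction y with
  | zero => simp
  | add x x' hx hx' => simp only [TensorProduct.add_tmul, TensorProduct.tmul_add, map_add, hx, hx']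
  | tmul b g =>
  induction z with
  | zero => simp
  | add x x' hx hx' => simp only [TensorProduct.tmul_add, map_add, hx, hx']
  | tmul c e =>
  have hco := LinearMap.congr_fun (coassoc (k := k) (H := H) (A := A)) c
  change TensorProduct.assoc k A H H ((coaction k H A).rTensor H (coaction k H A c)) =
    (comul (R := k)).lTensor A (coaction k H A c) at hco
  rw [smashMul_tmul, smashMul_tmul]
  have hR : ∀ s : A ⊗[k] H,
      smashMul k H A ((a ⊗ₜ h) ⊗ₜ TensorProduct.map (LinearMap.mulLeft k b)
        (LinearMap.mulRight k e ∘ₗ translate g) s) =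
      TensorProduct.map (LinearMap.mulLeft k a)
        (LinearMap.mulRight k e ∘ₗ LinearMap.mul' k _ ∘ₗ
          TensorProduct.map (translate h) (translate g))
        (TensorProduct.assoc k A H H (((LinearMap.mulLeft k (coaction k H A b)).rTensor H)
          ((coaction k H A).rTensor H s))) := by
    intro s
    induction s with
    | zero => simp
    | add s s' hs hs' => simp only [TensorProduct.tmul_add, map_add, hs, hs']
    | tmul x y =>
      simp only [TensorProduct.map_tmul, LinearMap.mulLeft_apply, smashMul_tmul, coaction_mul,
        LinearMap.rTensor_tmul]
      generalize coaction k H A b * coaction k H A x = r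
      induction r with
      | zero => simp
      | add s s' hs hs' => simp only [TensorProduct.add_tmul, map_add, hs, hs']
      | tmul p q => simp [mul_assoc]
  have hL : ∀ r : A ⊗[k] H,
      smashMul k H A (TensorProduct.map (LinearMap.mulLeft k a)
        (LinearMap.mulRight k g ∘ₗ translate h) r ⊗ₜ (c ⊗ₜ e)) =
      TensorProduct.map (LinearMap.mulLeft k a)
        (LinearMap.mulRight k e ∘ₗ LinearMap.mul' k _ ∘ₗ
          TensorProduct.map (translate h) (translate g))
        (TensorProduct.assoc k A H H (((LinearMap.mulLeft k r).rTensor H)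
          ((TensorProduct.assoc k A H H).symm
            ((comul (R := k)).lTensor A (coaction k H A c))))) := by
    intro r
    induction r with
    | zero => simp
    | add r r' hr hr' =>
      have : LinearMap.mulLeft k (r + r') = LinearMap.mulLeft k r + LinearMap.mulLeft k r' := by
        ext; simp [add_mul]
      simp only [TensorProduct.add_tmul, map_add, hr, hr', this, LinearMap.rTensor_add,
        LinearMap.add_apply]
    | tmul p q =>
      simp only [TensorProduct.map_tmul, LinearMap.mulLeft_apply, smashMul_tmul,
        LinearMap.comp_apply, LinearMap.mulRight_apply]
      generalize coaction k H A c = s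
      induction s with
      | zero => simp
      | add s s' hs hs' => simp only [map_add, hs, hs']
      | tmul x y =>
        simp only [TensorProduct.map_tmul, LinearMap.mulLeft_apply, LinearMap.comp_apply,
          LinearMap.mulRight_apply, translate_mul, LinearMap.lTensor_tmul]
        generalize comul (R := k) y = t
        induction t with
        | zero => simp
        | add s s' hs hs' =>
          simp only [map_add, TensorProduct.tmul_add, add_mul, hs, hs']
        | tmul y₁ y₂ => simp [translate_translate, mul_assoc]
  rw [hL, hR, ← hco, LinearEquiv.symm_apply_apply]

theorem smash_mul_add (x y z : A ⊗[k] HopfDual k H) : smashMul k H A (x ⊗ₜ (y + z)) =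
    smashMul k H A (x ⊗ₜ y) + smashMul k H A (x ⊗ₜ z) := by
  rw [TensorProduct.tmul_add, map_add]

theorem smash_add_mul (x y z : A ⊗[k] HopfDual k H) : smashMul k H A ((x + y) ⊗ₜ z) =
    smashMul k H A (x ⊗ₜ z) + smashMul k H A (y ⊗ₜ z) := by
  rw [TensorProduct.add_tmul, map_add]

theorem smash_zero_mul (x : A ⊗[k] HopfDual k H) : smashMul k H A (0 ⊗ₜ x) = 0 := by
  rw [TensorProduct.zero_tmul, map_zero]

theorem smash_mul_zero (x : A ⊗[k] HopfDual k H) : smashMul k H A (x ⊗ₜ 0) = 0 := by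
  rw [TensorProduct.tmul_zero, map_zero]

theorem smash_smul_mul (c : k) (x y : A ⊗[k] HopfDual k H) :
    smashMul k H A ((c • x) ⊗ₜ y) = c • smashMul k H A (x ⊗ₜ y) := by
  rw [← TensorProduct.smul_tmul', map_smul]

theorem smash_mul_smul (c : k) (x y : A ⊗[k] HopfDual k H) :
    smashMul k H A (x ⊗ₜ (c • y)) = c • smashMul k H A (x ⊗ₜ y) := by
  rw [TensorProduct.tmul_smul, map_smul]

variable (k H A) in
/-- The smash product `A # H*`: the space `A ⊗ H*` with the product
`(a # f)(b # g) = ∑ a (f₁ · b) # f₂ g` and unit `1 # ε`. -/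
def SmashProduct : Type (max w u v) := A ⊗[k] HopfDual k H

instance : Ring (SmashProduct k H A) where
  __ := (inferInstance : AddCommGroup (A ⊗[k] HopfDual k H))
  mul x y := smashMul k H A (x ⊗ₜ y)
  one := (1 : A) ⊗ₜ (1 : HopfDual k H)
  left_distrib := smash_mul_add
  right_distrib := smash_add_mul
  zero_mul := smash_zero_mul
  mul_zero := smash_mul_zero
  mul_assoc := smash_mul_assoc
  one_mul := smash_one_mul
  mul_one := smash_mul_one

instance : Algebra k (SmashProduct k H A) :=
  letI : Module k (SmashProduct k H A) :=
    (inferInstance : Module k (A ⊗[k] HopfDual k H))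
  Algebra.ofModule smash_smul_mul smash_mul_smul

variable (k H A) in
/-- The identification of the vector space `A # H*` with `A ⊗ H*`. -/
def toTensor : SmashProduct k H A ≃ₗ[k] A ⊗[k] HopfDual k H where
  toFun x := x
  invFun x := x
  map_add' _ _ := rfl
  map_smul' _ _ := rfl
  left_inv _ := rfl
  right_inv _ := rfl

instance [Module.Finite k A] : Module.Finite k (SmashProduct k H A) :=
  haveI : Module.Finite k (HopfDual k H) := Module.Finite.equiv (toForm k H).symm
  Module.Finite.equiv (toTensor k H A).symm

theorem toTensor_mul (x y : SmashProduct k H A) :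
    toTensor k H A (x * y) = smashMul k H A (toTensor k H A x ⊗ₜ toTensor k H A y) := rfl

theorem toTensor_one : toTensor k H A 1 = 1 ⊗ₜ 1 := rfl

variable (k H A) in
/-- The coaction of `H*` on `A # H*`: `a # f ↦ ∑ (a # f₁) ⊗ f₂`. -/
def smashCoact : SmashProduct k H A →ₗ[k] SmashProduct k H A ⊗[k] HopfDual k H :=
  (toTensor k H A).symm.toLinearMap.rTensor (HopfDual k H) ∘ₗ
    (TensorProduct.assoc k A (HopfDual k H) (HopfDual k H)).symm.toLinearMap ∘ₗ
    (comul (R := k)).lTensor A ∘ₗ (toTensor k H A).toLinearMap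

theorem comul_translate (h : HopfDual k H) (x : H) :
    comul (R := k) (translate h x) =
      ((toForm k H).symm.toLinearMap ∘ₗ (LinearMap.mulLeft k x).dualMap ∘ₗ
        (toForm k H).toLinearMap).rTensor (HopfDual k H) (comul (R := k) h) := by
  apply ext_tensor
  intro y z
  rw [pairing_comul, translate_apply, ← mul_assoc, ← pairing_comul]
  generalize comul (R := k) h = r
  induction r with
  | zero => simp
  | add s s' hs hs' => simp only [map_add, LinearMap.add_apply, hs, hs']
  | tmul p q => simp

theorem smashCoact_tmul (a : A) (h : HopfDual k H) :
    smashCoact k H A ((toTensor k H A).symm (a ⊗ₜ h)) =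
      ((toTensor k H A).symm.toLinearMap ∘ₗ TensorProduct.mk k A _ a).rTensor _
        (comul (R := k) h) := by
  simp only [smashCoact, LinearMap.comp_apply, LinearEquiv.coe_coe, LinearEquiv.apply_symm_apply,
    LinearMap.lTensor_tmul, LinearMap.rTensor_comp]
  generalize comul (R := k) h = r
  induction r with
  | zero => simp
  | add x x' hx hx' => simp only [map_add, TensorProduct.tmul_add, hx, hx']
  | tmul p q => simp

theorem smashCoact_one : smashCoact k H A 1 = 1 := by
  simp [smashCoact, toTensor_one, Algebra.TensorProduct.one_def]
  rfl

theorem smashCoact_mul (x y : SmashProduct k H A) :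
    smashCoact k H A (x * y) = smashCoact k H A x * smashCoact k H A y := by
  obtain ⟨x, rfl⟩ := (toTensor k H A).symm.surjective x
  obtain ⟨y, rfl⟩ := (toTensor k H A).symm.surjective y
  induction x with
  | zero => simp
  | add x x' hx hx' => simp only [map_add, add_mul, hx, hx']
  | tmul a h =>
  induction y with
  | zero => simp
  | add x x' hx hx' => simp only [map_add, mul_add, hx, hx']
  | tmul b g =>
  have h2' : ∀ h g : HopfDual k H, (toTensor k H A).symm (a ⊗ₜ h) * (toTensor k H A).symm (b ⊗ₜ g) =
      (toTensor k H A).symm (TensorProduct.map (LinearMap.mulLeft k a)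
        (LinearMap.mulRight k g ∘ₗ translate h) (coaction k H A b)) := by
    intro h g
    rw [← smashMul_tmul]; rfl
  have e1 := (ℛ k h).eq
  have e2 := (ℛ k g).eq
  rw [h2', smashCoact_tmul, smashCoact_tmul, ← e1, ← e2]
  simp only [map_sum, Finset.sum_mul_sum, LinearMap.rTensor_tmul, LinearMap.comp_apply,
    TensorProduct.mk_apply, LinearEquiv.coe_coe, Algebra.TensorProduct.tmul_mul_tmul, h2']
  generalize coaction k H A b = s
  induction s with
  | zero => simp
  | add x x' hx hx' =>
    simp only [map_add, hx, hx', TensorProduct.add_tmul, Finset.sum_add_distrib]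
  | tmul p q =>
    simp only [TensorProduct.map_tmul, LinearMap.comp_apply, LinearMap.mulLeft_apply,
      LinearMap.mulRight_apply, smashCoact_tmul, Bialgebra.comul_mul, comul_translate]
    rw [← e1, ← e2]
    simp only [map_sum, Finset.sum_mul_sum, LinearMap.rTensor_tmul, LinearMap.comp_apply,
      TensorProduct.mk_apply, LinearEquiv.coe_coe, Algebra.TensorProduct.tmul_mul_tmul]
    rfl

/-- `A # H*` as a right `H*`-comodule algebra. -/
instance : RightComoduleAlgebra k (HopfDual k H) (SmashProduct k H A) where
  coact := AlgHom.ofLinearMap (smashCoact k H A) smashCoact_one smashCoact_mul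
  coassoc := by
    refine LinearMap.ext fun z => ?_
    obtain ⟨z, rfl⟩ := (toTensor k H A).symm.surjective z
    change TensorProduct.assoc k _ _ _ ((smashCoact k H A).rTensor _
      (smashCoact k H A ((toTensor k H A).symm z))) =
        (comul (R := k)).lTensor _ (smashCoact k H A ((toTensor k H A).symm z))
    induction z with
    | zero => simp
    | add x x' hx hx' => simp only [map_add, hx, hx']
    | tmul a h =>
      have hc := coassoc_apply (R := k) h
      simp only [smashCoact_tmul]
      have hL : ∀ r : HopfDual k H ⊗[k] HopfDual k H, TensorProduct.assoc k _ _ _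
          ((smashCoact k H A).rTensor _ (((toTensor k H A).symm.toLinearMap ∘ₗ
            TensorProduct.mk k A _ a).rTensor _ r)) =
          ((toTensor k H A).symm.toLinearMap ∘ₗ TensorProduct.mk k A _ a).rTensor _
            (TensorProduct.assoc k _ _ _ ((comul (R := k)).rTensor _ r)) := by
        intro r
        induction r with
        | zero => simp
        | add x x' hx hx' => simp only [map_add, hx, hx']
        | tmul p q =>
          simp only [LinearMap.rTensor_tmul, LinearMap.comp_apply, LinearEquiv.coe_coe,
            TensorProduct.mk_apply, smashCoact_tmul]
          generalize comul (R := k) p = t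
          induction t with
          | zero => simp
          | add x x' hx hx' => simp only [map_add, TensorProduct.add_tmul, hx, hx']
          | tmul p q => simp
      rw [hL, hc]
      generalize comul (R := k) h = r
      induction r with
      | zero => simp
      | add x x' hx hx' => simp only [map_add, hx, hx']
      | tmul p q => simp
  counit_coact := by
    refine LinearMap.ext fun z => ?_
    obtain ⟨z, rfl⟩ := (toTensor k H A).symm.surjective z
    change TensorProduct.rid k _ ((counit (R := k)).lTensor _
      (smashCoact k H A ((toTensor k H A).symm z))) = (toTensor k H A).symm z
    induction z with
    | zero => simp
    | add x x' hx hx' => simp only [map_add, hx, hx']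
    | tmul a h =>
      rw [smashCoact_tmul, ← LinearMap.comp_apply, LinearMap.lTensor_comp_rTensor,
        ← LinearMap.rTensor_comp_lTensor, LinearMap.comp_apply, lTensor_counit_comul]
      simp

end Smash

section Distinguished

variable (k) in
/-- `t` is a left integral in `H`: `h t = ε(h) t` for all `h`. For the dual Hopf algebra, where
`ε(f) = f(1)`, this is the notion of a left integral on `H`. -/
def IsLeftIntegral (t : H) : Prop := ∀ h : H, h * t = counit (R := k) h • t

/-- `α` is the distinguished grouplike element of `H*`: `α` is a character with `t h = α(h) t` for
every left integral `t` in `H` and all `h`. -/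
def IsDistinguishedCharacter (α : H →ₐ[k] k) : Prop :=
  ∀ t : H, IsLeftIntegral k t → ∀ h : H, t * h = α h • t

/-- `g` is the distinguished grouplike element of `H`: `g` is grouplike with `T f = f(g) T` for every
left integral `T` on `H` and all `f` in `H*`. -/
def IsDistinguishedGroupLike [Module.Finite k H] (g : GroupLike k H) : Prop :=
  ∀ T : HopfDual k H, IsLeftIntegral k T → ∀ f : HopfDual k H, T * f = f (g : H) • T

/-- A grouplike element `g` of `H` as a character of `H*`: `f ↦ f(g)`. -/
def evalChar (g : GroupLike k H) : HopfDual k H →ₐ[k] k :=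
  AlgHom.ofLinearMap (evalAt k (g : H)) (by simp [g.2.counit_eq_one])
    (by intro f f'; simp [hopfDual_mul_apply, g.2.comul_eq_tmul_self])

end Distinguished
end Comodule
end HopfSmash
end

/-!
A symmetric structure `θ : B ≃ B*` on a comodule algebra `B` is determined by the linear form
`l = θ(1)`, as `θ(x) = l(x ·)`. So `B` is `(L, u)`-symmetric exactly when `u` is sovereign and `B`
carries a nondegenerate colinear form `l` with `l(a b) = l(b (u⁻¹ · a))` (`isSymmetric_iff`), and the
proof compares such forms on `A` and on `A # H*`.

Fix a right integral `t ≠ 0` in `H`. Evaluated at a fixed `a`, a colinear form on `A # H*` is a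
linear form on `H*`, that is, an element of `H`, and colinearity says that this element is a right
integral. As right integrals are unique up to scalars, the colinear forms are the forms
`a # f ↦ l(a) f(t)` with `l` an arbitrary linear form on `A` (`exists_eq_smashForm`). The twisted
trace identity for such a form is an identity between elements of `H` acting on the two legs of
`Δ(t)`. Two facts rewrite it: `∑ t₁ ⊗ t₂ = ∑ t₂ g⁻¹ ⊗ t₁`, valid because `S²` is conjugation by `g`
(`comul_eq_comm_comul_mul`), and `h t = α⁻¹(h) t`, which moves left multiplications from the second
leg to the first (`one_tmul_mul_comul`). What remains (`smashForm_twisted_iff`) is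
`∑ l(a b₀) b₁ = S(∑ l(b a'₀) a'₁)` with `a' = α⁻¹ · a`, and this is equivalent to `l` being colinear
and satisfying its own twisted trace identity (`colinear_and_twisted_iff`). Nondegeneracy passes
between the two forms by the Frobenius property of `Δ(t)` (`smashForm_nondegenerate_iff`).

The theory of integrals used here is developed from the definitions. A nonzero left integral is
obtained as a partial trace (`exists_isLeftIntegral_ne_zero`): the canonical invariant of `K ⊗ K*`
is carried to integrals by the isomorphism of `K ⊗ K*` with a free module. A nonzero left integral
`T` on `H` gives a nondegenerate form `T(x y)` (`leftForm_injective`), which yields `t` and its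
uniqueness.
-/

noncomputable section
namespace HopfSmash
open TensorProduct Coalgebra HopfAlgebra

/-! ### Contractions of tensors -/

section Contraction
variable {k M N : Type*} [CommSemiring k] [AddCommMonoid M] [AddCommMonoid N] [Module k M]
  [Module k N]

/-- The contraction `M ⊗ N → N`, `m ⊗ n ↦ φ(m) n`. -/
def contractLeft (φ : M →ₗ[k] k) : M ⊗[k] N →ₗ[k] N :=
  (TensorProduct.lid k N).toLinearMap ∘ₗ φ.rTensor N

/-- The contraction `M ⊗ N → M`, `m ⊗ n ↦ φ(n) m`. -/
def contractRight (φ : N →ₗ[k] k) : M ⊗[k] N →ₗ[k] M :=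
  (TensorProduct.rid k M).toLinearMap ∘ₗ φ.lTensor M

@[simp] theorem contractLeft_tmul (φ : M →ₗ[k] k) (m : M) (n : N) :
    contractLeft φ (m ⊗ₜ[k] n) = φ m • n := by simp [contractLeft]

@[simp] theorem contractRight_tmul (φ : N →ₗ[k] k) (m : M) (n : N) :
    contractRight φ (m ⊗ₜ[k] n) = φ n • m := by simp [contractRight]

end Contraction

section ContractionAlgebra
variable {k A B : Type*} [CommSemiring k] [Semiring A] [Semiring B] [Algebra k A] [Algebra k B]

theorem contractLeft_mul_one_tmul (φ : A →ₗ[k] k) (b : B) (w : A ⊗[k] B) :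
    contractLeft φ (w * (1 ⊗ₜ[k] b)) = contractLeft φ w * b := by
  induction w with
  | zero => simp
  | add x y hx hy => simp only [add_mul, map_add, hx, hy]
  | tmul x y => simp

theorem contractRight_tmul_one_mul (φ : B →ₗ[k] k) (a : A) (w : A ⊗[k] B) :
    contractRight φ ((a ⊗ₜ[k] 1) * w) = a * contractRight φ w := by
  induction w with
  | zero => simp
  | add x y hx hy => simp only [mul_add, map_add, hx, hy]
  | tmul x y => simp

theorem contractRight_mul_tmul_one (φ : B →ₗ[k] k) (a : A) (w : A ⊗[k] B) :
    contractRight φ (w * (a ⊗ₜ[k] 1)) = contractRight φ w * a := by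
  induction w with
  | zero => simp
  | add x y hx hy => simp only [add_mul, map_add, hx, hy]
  | tmul x y => simp

theorem contractRight_mul_one_tmul (φ : B →ₗ[k] k) (b : B) (w : A ⊗[k] B) :
    contractRight φ (w * (1 ⊗ₜ[k] b)) = contractRight (φ ∘ₗ LinearMap.mulRight k b) w := by
  induction w with
  | zero => simp
  | add x y hx hy => simp only [add_mul, map_add, hx, hy]
  | tmul x y => simp

theorem contractLeft_tmul_one_mul (φ : A →ₗ[k] k) (a : A) (w : A ⊗[k] B) :
    contractLeft φ ((a ⊗ₜ[k] 1) * w) = contractLeft (φ ∘ₗ LinearMap.mulLeft k a) w := by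
  induction w with
  | zero => simp
  | add x y hx hy => simp only [mul_add, map_add, hx, hy]
  | tmul x y => simp

end ContractionAlgebra

/-! ### Antipode identities -/

section HopfIdentities
variable {k H : Type*} [Field k] [Ring H] [HopfAlgebra k H]

theorem contractRight_counit_comul (x : H) :
    contractRight (counit (R := k) (A := H)) (comul (R := k) x) = x := by
  simp [contractRight, lTensor_counit_comul]

/-- If `φ(x₁ ⊗ x₂) = ε(x) 1` for all `x`, then `∑ x₁ ⊗ φ(x₂ ⊗ x₃) = x ⊗ 1`. -/
theorem sum_lTensor_assoc_comul {x : H} {ι : Type*} (r : Repr k x ι) (φ : H ⊗[k] H →ₗ[k] H)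
    (hφ : ∀ y : H, φ (comul (R := k) y) = algebraMap k H (counit (R := k) y)) :
    ∑ i ∈ r.index, φ.lTensor H (TensorProduct.assoc k H H H (comul (R := k) (r.left i) ⊗ₜ[k]
      r.right i)) = x ⊗ₜ[k] 1 := by
  have h := congrArg (φ.lTensor H) (coassoc_apply (R := k) x)
  rw [← LinearMap.lTensor_comp_apply, show φ ∘ₗ comul = Algebra.linearMap k H ∘ₗ counit from
    LinearMap.ext hφ, LinearMap.lTensor_comp_apply, lTensor_counit_comul] at h
  rw [← r.eq] at h
  simpa using h

/-- If `φ(x₁ ⊗ x₂) = ε(x) 1` for all `x`, then `∑ φ(x₁ ⊗ x₂) ⊗ x₃ = 1 ⊗ x`. -/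
theorem sum_rTensor_assoc_symm_comul {x : H} {ι : Type*} (r : Repr k x ι)
    (φ : H ⊗[k] H →ₗ[k] H)
    (hφ : ∀ y : H, φ (comul (R := k) y) = algebraMap k H (counit (R := k) y)) :
    ∑ i ∈ r.index, φ.rTensor H ((TensorProduct.assoc k H H H).symm (r.left i ⊗ₜ[k]
      comul (R := k) (r.right i))) = 1 ⊗ₜ[k] x := by
  have h := congrArg (φ.rTensor H) (coassoc_symm_apply (R := k) x)
  rw [← LinearMap.rTensor_comp_apply, show φ ∘ₗ comul = Algebra.linearMap k H ∘ₗ counit from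
    LinearMap.ext hφ, LinearMap.rTensor_comp_apply, rTensor_counit_comul] at h
  rw [← r.eq] at h
  simpa using h

/-- `∑ Δ(x₁) (1 ⊗ S(x₂)) = x ⊗ 1`. -/
theorem sum_comul_mul_one_tmul_antipode {x : H} {ι : Type*} (r : Repr k x ι) :
    ∑ i ∈ r.index, comul (R := k) (r.left i) * (1 ⊗ₜ[k] antipode k (r.right i)) =
      x ⊗ₜ[k] 1 := by
  rw [← sum_lTensor_assoc_comul r (LinearMap.mul' k H ∘ₗ (antipode k).lTensor H)
    (fun y => mul_antipode_lTensor_comul_apply (R := k) y)]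
  refine Finset.sum_congr rfl fun i _ => ?_
  generalize comul (R := k) (r.left i) = w
  induction w with
  | zero => simp
  | add x y hx hy => simp only [add_mul, TensorProduct.add_tmul, map_add, hx, hy]
  | tmul p q => simp

/-- `∑ (S(x₁) ⊗ 1) Δ(x₂) = 1 ⊗ x`. -/
theorem sum_antipode_tmul_one_mul_comul {x : H} {ι : Type*} (r : Repr k x ι) :
    ∑ i ∈ r.index, (antipode k (r.left i) ⊗ₜ[k] 1) * comul (R := k) (r.right i) =
      1 ⊗ₜ[k] x := by
  rw [← sum_rTensor_assoc_symm_comul r (LinearMap.mul' k H ∘ₗ (antipode k).rTensor H)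
    (fun y => mul_antipode_rTensor_comul_apply (R := k) y)]
  refine Finset.sum_congr rfl fun i _ => ?_
  generalize comul (R := k) (r.right i) = w
  induction w with
  | zero => simp
  | add x y hx hy => simp only [mul_add, TensorProduct.tmul_add, map_add, hx, hy]
  | tmul p q => simp

/-- `∑ x₁ ⊗ S(x₂) x₃ = x ⊗ 1`. -/
theorem sum_lTensor_antipode_comul_mul {x : H} {ι : Type*} (r : Repr k x ι) :
    ∑ i ∈ r.index, (antipode k).lTensor H (comul (R := k) (r.left i)) * (1 ⊗ₜ[k] r.right i) =
      x ⊗ₜ[k] 1 := by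
  rw [← sum_lTensor_assoc_comul r (LinearMap.mul' k H ∘ₗ (antipode k).rTensor H)
    (fun y => mul_antipode_rTensor_comul_apply (R := k) y)]
  refine Finset.sum_congr rfl fun i _ => ?_
  generalize comul (R := k) (r.left i) = w
  induction w with
  | zero => simp
  | add x y hx hy => simp only [add_mul, TensorProduct.add_tmul, map_add, hx, hy]
  | tmul p q => simp

end HopfIdentities

/-! ### Existence of integrals -/

section Existence
variable {k K : Type*} [Field k] [Ring K] [HopfAlgebra k K]

/-- An operator on the second leg of `∑ eᵢ ⊗ eⁱ` can be moved to the first leg. -/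
theorem sum_coord_comp_eq {V M ι : Type*} [AddCommGroup V] [Module k V] [AddCommGroup M]
    [Module k M] [Fintype ι] (b : Module.Basis ι k V) (L : V →ₗ[k] V)
    (F : Module.Dual k V →ₗ[k] V →ₗ[k] M) :
    ∑ i, F (b.coord i ∘ₗ L) (b i) = ∑ i, F (b.coord i) (L (b i)) := by
  have h1 : ∀ i, b.coord i ∘ₗ L = ∑ j, b.coord i (L (b j)) • b.coord j := by
    intro i
    refine b.ext fun m => ?_
    classical
    simp [LinearMap.sum_apply, Finsupp.single_apply]
  have h2 : ∀ i, L (b i) = ∑ j, b.coord j (L (b i)) • b j := fun i => (b.sum_repr _).symm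
  calc ∑ i, F (b.coord i ∘ₗ L) (b i)
      = ∑ i, ∑ j, b.coord i (L (b j)) • F (b.coord j) (b i) := by
        refine Finset.sum_congr rfl fun i _ => ?_
        rw [h1 i]; simp [LinearMap.sum_apply]
    _ = ∑ j, ∑ i, b.coord i (L (b j)) • F (b.coord j) (b i) := Finset.sum_comm
    _ = _ := by
        refine Finset.sum_congr rfl fun j _ => ?_
        conv_rhs => rw [h2 j]
        simp only [map_sum, map_smul]

/-- The bilinear map `(φ, z) ↦ ∑ φ(S²(z₂) y) z₁`. -/
def traceKernel (y : K) : Module.Dual k K →ₗ[k] K →ₗ[k] K :=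
  LinearMap.mk₂ k (fun φ z => contractRight
      (φ ∘ₗ LinearMap.mulRight k y ∘ₗ antipode k ∘ₗ antipode k) (comul (R := k) z))
    (fun φ ψ z => by simp [contractRight, LinearMap.add_comp, LinearMap.lTensor_add])
    (fun c φ z => by simp [contractRight, LinearMap.smul_comp, LinearMap.lTensor_smul])
    (fun φ z w => by simp) (fun c φ z => by simp)

theorem traceKernel_apply (y : K) (φ : Module.Dual k K) (z : K) :
    traceKernel y φ z = contractRight
      (φ ∘ₗ LinearMap.mulRight k y ∘ₗ antipode k ∘ₗ antipode k) (comul (R := k) z) := rfl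

/-- The partial trace `∑ᵢ eⁱ(S²(eᵢ₂) y) eᵢ₁`, where `eᵢ` and `eⁱ` are dual bases. -/
def traceIntegral {ι : Type*} [Fintype ι] (b : Module.Basis ι k K) (y : K) : K :=
  ∑ i, traceKernel y (b.coord i) (b i)

/-- Left multiplication by `h` moves inside as `h₁` on `z` and `S(h₂)` on the argument of `φ`. Summed over
dual bases, the two cancel to `h₁ S(h₂)`. -/
theorem mul_traceKernel {h : K} {ι : Type*} (r : Repr k h ι) (y : K) (φ : Module.Dual k K) (z : K) :
    h * traceKernel y φ z =
      ∑ j ∈ r.index, traceKernel y (φ ∘ₗ LinearMap.mulLeft k (antipode k (r.right j)))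
        (r.left j * z) := by
  simp only [traceKernel_apply, Bialgebra.comul_mul]
  rw [← contractRight_tmul_one_mul]
  generalize comul (R := k) z = w
  induction w with
  | zero => simp
  | add x y hx hy => simp only [mul_add, map_add, hx, hy, Finset.sum_add_distrib]
  | tmul p q =>
    have h1 := congrArg (contractRight (φ ∘ₗ LinearMap.mulRight k (antipode k (antipode k q) * y)
      ∘ₗ antipode k)) (sum_lTensor_antipode_comul_mul r)
    have h2 := congrArg (· * p) h1
    simp only [map_sum, Finset.sum_mul] at h2
    rw [Algebra.TensorProduct.tmul_mul_tmul]
    refine Eq.trans ?_ (h2.symm.trans (Finset.sum_congr rfl fun j _ => ?_))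
    · simp
    · generalize comul (R := k) (r.left j) = s
      induction s with
      | zero => simp
      | add x y hx hy => simp only [add_mul, map_add, hx, hy]
      | tmul c d => simp [antipode_mul_antidistrib, mul_assoc]

theorem isLeftIntegral_traceIntegral {ι : Type*} [Fintype ι] (b : Module.Basis ι k K) (y : K) :
    IsLeftIntegral k (traceIntegral b y) := by
  intro h
  have r := ℛ k h
  simp only [traceIntegral, Finset.mul_sum, mul_traceKernel r]
  rw [Finset.sum_comm]
  calc ∑ j ∈ r.index, ∑ i, traceKernel y
          (b.coord i ∘ₗ LinearMap.mulLeft k (antipode k (r.right j))) (r.left j * b i)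
      = ∑ j ∈ r.index, ∑ i, traceKernel y (b.coord i)
          (r.left j * (antipode k (r.right j) * b i)) :=
        Finset.sum_congr rfl fun j _ => sum_coord_comp_eq b
          (LinearMap.mulLeft k (antipode k (r.right j)))
          ((traceKernel y).compl₂ (LinearMap.mulLeft k (r.left j)))
    _ = ∑ i, traceKernel y (b.coord i) (∑ j ∈ r.index,
          r.left j * (antipode k (r.right j) * b i)) := by
        rw [Finset.sum_comm]; simp only [map_sum]
    _ = _ := by
        rw [Finset.smul_sum]
        refine Finset.sum_congr rfl fun i _ => ?_
        simp only [← mul_assoc, ← Finset.sum_mul, sum_mul_antipode_eq_smul r]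
        simp

/-- The values `traceKernel y φ z` determine `φ(y) z`: contracting the second leg of their coproducts
against `S` undoes the multiplication by `S²(z₂)`. -/
theorem sum_contract_comul_traceKernel {ι : Type*} [Fintype ι] (b : Module.Basis ι k K)
    (φ : Module.Dual k K) (z y : K) :
    ∑ m, contractRight (b.coord m ∘ₗ LinearMap.mulRight k y ∘ₗ antipode k)
      (comul (R := k) (traceKernel (b m) φ z)) = φ y • z := by
  have r := ℛ k z
  have h1 : ∀ m, traceKernel (b m) φ z =
      ∑ i ∈ r.index, φ (antipode k (antipode k (r.right i)) * b m) • r.left i := by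
    intro m
    rw [traceKernel_apply, ← r.eq]
    simp
  have h2 : ∀ i, ∑ m, φ (antipode k (antipode k (r.right i)) * b m) •
      contractRight (b.coord m ∘ₗ LinearMap.mulRight k y ∘ₗ antipode k) (comul (R := k) (r.left i))
      = contractRight (φ ∘ₗ LinearMap.mulRight k y ∘ₗ antipode k)
        (comul (R := k) (r.left i) * (1 ⊗ₜ[k] antipode k (r.right i))) := by
    intro i
    generalize comul (R := k) (r.left i) = w
    induction w with
    | zero => simp
    | add x y hx hy => simp only [add_mul, map_add, smul_add, Finset.sum_add_distrib, hx, hy]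
    | tmul p q =>
      have h3 : antipode k (antipode k (r.right i)) * (antipode k q * y) =
          ∑ m, b.coord m (antipode k q * y) • (antipode k (antipode k (r.right i)) * b m) := by
        conv_lhs => rw [← b.sum_repr (antipode k q * y)]
        simp only [Finset.mul_sum, mul_smul_comm, Module.Basis.coord_apply]
      simp only [contractRight_tmul, Algebra.TensorProduct.tmul_mul_tmul, mul_one,
        LinearMap.comp_apply, LinearMap.mulRight_apply, antipode_mul_antidistrib]
      rw [mul_assoc, h3]
      simp only [map_sum, map_smul, Finset.sum_smul, smul_smul, smul_eq_mul, mul_comm]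
  have h4 := congrArg (contractRight (φ ∘ₗ LinearMap.mulRight k y ∘ₗ antipode k))
    (sum_comul_mul_one_tmul_antipode r)
  rw [map_sum] at h4
  simp only [h1, map_sum, map_smul]
  rw [Finset.sum_comm, Finset.sum_congr rfl fun i _ => h2 i, h4]
  simp

/-- A finite dimensional Hopf algebra has a nonzero left integral. -/
theorem exists_isLeftIntegral_ne_zero [Module.Finite k K] :
    ∃ t : K, t ≠ 0 ∧ IsLeftIntegral k t := by
  let b := Module.finBasis k K
  by_contra! hcon
  have h0 : ∀ y, traceIntegral b y = 0 := fun y => by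
    by_contra hne
    exact hcon _ hne (isLeftIntegral_traceIntegral b y)
  have h1 : ∀ y : K, y = 0 := by
    intro y
    have h2 : ∑ m, contractRight (b.coord m ∘ₗ LinearMap.mulRight k y ∘ₗ antipode k)
      (comul (R := k) (traceIntegral b (b m))) = 0 := by simp [h0]
    simp only [traceIntegral, map_sum] at h2
    rw [Finset.sum_comm] at h2
    simp only [sum_contract_comul_traceKernel, Module.Basis.coord_apply, b.sum_repr] at h2
    exact h2
  have h3 := congrArg (counit (R := k) (A := K)) (h1 1)
  simp at h3

end Existence
/-! ### Integrals and the Frobenius property -/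

section Integrals
variable {k H : Type*} [Field k] [Ring H] [HopfAlgebra k H]

variable (k) in
/-- `t` is a right integral in `H`: `t h = ε(h) t` for all `h`. -/
def IsRightIntegral (t : H) : Prop := ∀ h : H, t * h = counit (R := k) h • t

/-- `∑ t₁ x ⊗ t₂ = ∑ t₁ ⊗ t₂ S(x)` for a right integral `t`. -/
theorem IsRightIntegral.comul_mul_tmul_one {t : H} (ht : IsRightIntegral k t) (x : H) :
    comul (R := k) t * (x ⊗ₜ[k] 1) = comul (R := k) t * (1 ⊗ₜ[k] antipode k x) := by
  have r := ℛ k x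
  have h1 : antipode k x = ∑ i ∈ r.index, counit (R := k) (r.left i) • antipode k (r.right i) := by
    conv_lhs => rw [← sum_counit_smul r]
    simp
  rw [← sum_comul_mul_one_tmul_antipode r, h1]
  simp only [Finset.mul_sum, ← mul_assoc, ← Bialgebra.comul_mul, ht (r.left _), tmul_sum]
  refine Finset.sum_congr rfl fun i _ => ?_
  simp

/-- The distinguished character is defined by left integrals. As `S(t)` is one for a right integral `t`,
applying `S` gives `h t = α⁻¹(h) t`. -/
theorem mul_eq_of_isRightIntegral {t : H} (ht : IsRightIntegral k t) {α : H →ₐ[k] k}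
    (hα : IsDistinguishedCharacter α) (hinj : Function.Injective (antipode k (A := H)))
    (hsurj : Function.Surjective (antipode k (A := H))) (h : H) :
    h * t = charInv α h • t := by
  have hl : IsLeftIntegral k (antipode k t) := by
    intro x
    obtain ⟨y, rfl⟩ := hsurj x
    rw [← antipode_mul_antidistrib, ht, counit_antipode, map_smul]
  apply hinj
  rw [antipode_mul_antidistrib, hα _ hl, map_smul]
  rfl

/-- `∑ t₁ ⊗ x t₂ = ∑ β(x₂) S(x₁) t₁ ⊗ t₂` when `h t = β(h) t` for all `h`. -/
theorem one_tmul_mul_comul {t : H} {β : H →ₗ[k] k} (ht : ∀ h, h * t = β h • t) (x : H) :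
    (1 ⊗ₜ[k] x) * comul (R := k) t =
      (antipode k (contractRight β (comul (R := k) x)) ⊗ₜ[k] 1) * comul (R := k) t := by
  have r := ℛ k x
  rw [← sum_antipode_tmul_one_mul_comul r]
  conv_rhs => rw [← r.eq]
  simp only [Finset.sum_mul, mul_assoc, ← Bialgebra.comul_mul, ht, map_sum, sum_tmul]
  refine Finset.sum_congr rfl fun i _ => ?_
  simp [← smul_tmul']

theorem eq_of_contractRight_eq {M N : Type*} [AddCommGroup M] [Module k M] [AddCommGroup N]
    [Module k N] [Module.Finite k N] {w w' : M ⊗[k] N}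
    (h : ∀ f : Module.Dual k N, contractRight f w = contractRight f w') : w = w' := by
  let b := Module.finBasis k N
  have key : ∀ w : M ⊗[k] N, ∑ i, contractRight (b.coord i) w ⊗ₜ[k] b i = w := by
    intro w
    induction w with
    | zero => simp
    | add x y hx hy =>
      simp only [map_add, add_tmul, Finset.sum_add_distrib, hx, hy]
    | tmul p q => simp only [contractRight_tmul, smul_tmul, ← tmul_sum, Module.Basis.coord_apply,
        b.sum_repr]
  rw [← key w, ← key w']
  simp only [h]

/-- The map `x ↦ T(· x)` from `H` to its linear dual. -/
def leftForm (T : HopfDual k H) : H →ₗ[k] Module.Dual k H :=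
  (LinearMap.mul k H).flip.compr₂ (toForm k H T)

@[simp] theorem leftForm_apply (T : HopfDual k H) (x y : H) : leftForm T x y = T (y * x) := rfl

variable [Module.Finite k H]

/-- The defining identity `F T = F(1) T`, read in `H`: `∑ T(x₂) x₁ = T(x) 1`. -/
theorem contractRight_comul_of_isLeftIntegral {T : HopfDual k H} (hT : IsLeftIntegral k T)
    (x : H) : contractRight (toForm k H T) (comul (R := k) x) = T x • 1 := by
  rw [← sub_eq_zero, ← Module.forall_dual_apply_eq_zero_iff k]
  intro F
  have h1 : ((toForm k H).symm F * T) x = F 1 * T x :=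
    congrArg (fun f : HopfDual k H => f x) (hT ((toForm k H).symm F))
  rw [map_sub, sub_eq_zero, map_smul, smul_eq_mul, mul_comm, ← h1, hopfDual_mul_apply]
  generalize comul (R := k) x = w
  induction w with
  | zero => simp
  | add x y hx hy => simp only [map_add, hx, hy]
  | tmul p q => simp [mul_comm]

/-- The identity `T f = f(g) T`, read in `H`: `∑ T(x₁) x₂ = T(x) g`. -/
theorem contractLeft_comul_of_isLeftIntegral {T : HopfDual k H} {g : H}
    (hT : ∀ f : HopfDual k H, T * f = f g • T) (x : H) :
    contractLeft (toForm k H T) (comul (R := k) x) = T x • g := by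
  rw [← sub_eq_zero, ← Module.forall_dual_apply_eq_zero_iff k]
  intro F
  have h1 : (T * (toForm k H).symm F) x = F g * T x :=
    congrArg (fun f : HopfDual k H => f x) (hT ((toForm k H).symm F))
  rw [map_sub, sub_eq_zero, map_smul, smul_eq_mul, mul_comm, ← h1, hopfDual_mul_apply]
  generalize comul (R := k) x = w
  induction w with
  | zero => simp
  | add x y hx hy => simp only [map_add, hx, hy]
  | tmul p q => simp

/-- The kernel of `x ↦ T(· x)` is a left ideal and a left coideal. Were `ε` nonzero on it, it would
contain `1`; so it lies in the kernel of `ε`, and a left coideal in the kernel of `ε` is zero. -/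
theorem leftForm_injective {T : HopfDual k H} (hT : IsLeftIntegral k T) (h0 : T ≠ 0) :
    Function.Injective (leftForm T) := by
  -- the left coideal property: `x₁ ⊗ T(· x₂) = 0`, evaluated at `y`
  have hco : ∀ x, leftForm T x = 0 → ∀ y,
      contractRight (toForm k H T) ((1 ⊗ₜ[k] y) * comul (R := k) x) = 0 := by
    intro x hx y
    have r := ℛ k y
    rw [← sum_antipode_tmul_one_mul_comul r]
    simp only [Finset.sum_mul, mul_assoc, ← Bialgebra.comul_mul, map_sum,
      contractRight_tmul_one_mul, contractRight_comul_of_isLeftIntegral hT]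
    refine Finset.sum_eq_zero fun i _ => ?_
    rw [← leftForm_apply, hx]
    simp
  have hco' : ∀ x, leftForm T x = 0 → (leftForm T).lTensor H (comul (R := k) x) = 0 := by
    intro x hx
    apply (TensorProduct.comm k _ _).injective
    apply (dualTensorHom_bijective (R := k) (M := H) (N := H)).1
    refine LinearMap.ext fun y => ?_
    rw [map_zero, map_zero, LinearMap.zero_apply, ← hco x hx y]
    generalize comul (R := k) x = w
    induction w with
    | zero => simp
    | add x y hx hy => simp only [map_add, LinearMap.add_apply, mul_add, hx, hy]
    | tmul p q => simp
  have hcounit : ∀ x, leftForm T x = 0 → counit (R := k) x = 0 := by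
    intro x hx
    by_contra hne
    refine h0 (hopfDual_ext fun y => ?_)
    have h2 : ∀ w : H ⊗[k] H, TensorProduct.lift (LinearMap.mk₂ k
        (fun (a : H) (f : Module.Dual k H) => f (y * antipode k a)) (by simp [mul_add]) (by simp)
        (by simp) (by simp)) ((leftForm T).lTensor H w) =
        T (y * LinearMap.mul' k H ((antipode k).rTensor H w)) := by
      intro w
      induction w with
      | zero => simp
      | add x y hx hy => simp only [map_add, mul_add, hx, hy]
      | tmul p q => simp [mul_assoc]
    have h3 := h2 (comul (R := k) x)
    rw [hco' x hx, map_zero, mul_antipode_rTensor_comul_apply] at h3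
    simp only [Algebra.algebraMap_eq_smul_one, mul_smul_comm, mul_one, map_smul,
      smul_eq_mul] at h3
    simpa [hne] using h3.symm
  rw [injective_iff_map_eq_zero]
  intro x hx
  have h4 : counit (R := k) (A := H) ∈ LinearMap.range (leftForm T).dualMap := by
    rw [LinearMap.range_dualMap_eq_dualAnnihilator_ker, Submodule.mem_dualAnnihilator]
    exact fun w hw => hcounit w hw
  obtain ⟨φ, hφ⟩ := h4
  rw [← contractRight_counit_comul (k := k) x, ← hφ]
  have h5 : ∀ w : H ⊗[k] H, contractRight ((leftForm T).dualMap φ) w =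
      contractRight φ ((leftForm T).lTensor H w) := by
    intro w
    induction w with
    | zero => simp
    | add x y hx hy => simp only [map_add, hx, hy]
    | tmul p q => simp
  rw [h5, hco' x hx, map_zero]

theorem leftForm_surjective {T : HopfDual k H} (hT : IsLeftIntegral k T) (h0 : T ≠ 0) :
    Function.Surjective (leftForm T) :=
  (LinearMap.injective_iff_surjective_of_finrank_eq_finrank
    (Subspace.dual_finrank_eq (K := k) (V := H)).symm).1 (leftForm_injective hT h0)

/-- The element representing `ε` in the form `(x, y) ↦ T(x y)` is a right integral. -/
theorem exists_isRightIntegral {T : HopfDual k H} (hT : IsLeftIntegral k T) (h0 : T ≠ 0) :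
    ∃ t : H, IsRightIntegral k t ∧ T t = 1 := by
  have hinj : Function.Injective (leftForm T).flip := by
    rw [injective_iff_map_eq_zero]
    intro x hx
    rw [← Module.forall_dual_apply_eq_zero_iff k]
    intro f
    obtain ⟨y, rfl⟩ := leftForm_surjective hT h0 f
    exact LinearMap.congr_fun hx y
  obtain ⟨t, ht⟩ := (LinearMap.injective_iff_surjective_of_finrank_eq_finrank
    (Subspace.dual_finrank_eq (K := k) (V := H)).symm).1 hinj (counit (R := k))
  have ht' : ∀ y, T (t * y) = counit (R := k) y := fun y => LinearMap.congr_fun ht y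
  refine ⟨t, fun h => hinj (LinearMap.ext fun y => ?_), by simpa using ht' 1⟩
  simp only [LinearMap.flip_apply, leftForm_apply, map_smul, LinearMap.smul_apply, mul_assoc, ht']
  simp

/-- Elements of `H ⊗ H` are separated by the contractions against `T(· S(x))`. -/
theorem eq_of_contractRight_mul_antipode_eq {T : HopfDual k H} (hT : IsLeftIntegral k T)
    (h0 : T ≠ 0) (hsurj : Function.Surjective (antipode k (A := H))) {w w' : H ⊗[k] H}
    (h : ∀ x, contractRight (toForm k H T) (w * (1 ⊗ₜ[k] antipode k x)) =
      contractRight (toForm k H T) (w' * (1 ⊗ₜ[k] antipode k x))) : w = w' := by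
  refine eq_of_contractRight_eq fun f => ?_
  obtain ⟨y, rfl⟩ := leftForm_surjective hT h0 f
  obtain ⟨x, rfl⟩ := hsurj y
  have := h x
  simp only [contractRight_mul_one_tmul] at this
  exact this

/-- `∑ T(t₂ S(x)) t₁ = T(t) x`: the coproduct of `t` is a Casimir element for the form given by `T`. -/
theorem contractRight_comul_mul_antipode {T : HopfDual k H} (hT : IsLeftIntegral k T) {t : H}
    (ht : IsRightIntegral k t) (x : H) :
    contractRight (toForm k H T) (comul (R := k) t * (1 ⊗ₜ[k] antipode k x)) = T t • x := by
  rw [← ht.comul_mul_tmul_one, contractRight_mul_tmul_one,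
    contractRight_comul_of_isLeftIntegral hT, smul_one_mul]

/-- Right integrals are unique up to scalars. -/
theorem IsRightIntegral.eq_smul {T : HopfDual k H} (hT : IsLeftIntegral k T)
    (h0 : T ≠ 0) (hsurj : Function.Surjective (antipode k (A := H))) {t t' : H}
    (ht : IsRightIntegral k t) (hTt : T t = 1) (ht' : IsRightIntegral k t') :
    t' = T t' • t := by
  have h : comul (R := k) t' = T t' • comul (R := k) t := by
    refine eq_of_contractRight_mul_antipode_eq hT h0 hsurj fun x => ?_
    rw [smul_mul_assoc, map_smul, contractRight_comul_mul_antipode hT ht,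
      contractRight_comul_mul_antipode hT ht', hTt, one_smul]
  conv_lhs => rw [← contractRight_counit_comul (k := k) t', h, map_smul,
    contractRight_counit_comul]

/-- When `S²` is conjugation by `g`, the coproduct of a right integral is symmetric up to `g`:
`∑ t₁ ⊗ t₂ = ∑ t₂ g⁻¹ ⊗ t₁`. -/
theorem comul_eq_comm_comul_mul {T : HopfDual k H} (hT : IsLeftIntegral k T)
    (h0 : T ≠ 0) (hsurj : Function.Surjective (antipode k (A := H))) {g : GroupLike k H}
    (hg : ∀ f : HopfDual k H, T * f = f (g : H) • T)
    (hSg : ∀ h : H, antipode k (antipode k h) = ((g⁻¹ : GroupLike k H) : H) * h * (g : H))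
    {t : H} (ht : IsRightIntegral k t) :
    comul (R := k) t = TensorProduct.comm k H H (comul (R := k) t) *
      (((g⁻¹ : GroupLike k H) : H) ⊗ₜ[k] 1) := by
  refine eq_of_contractRight_mul_antipode_eq hT h0 hsurj fun x => ?_
  have hc : ∀ w : H ⊗[k] H, contractRight (toForm k H T) (TensorProduct.comm k H H w *
      (((g⁻¹ : GroupLike k H) : H) ⊗ₜ[k] 1) * (1 ⊗ₜ[k] antipode k x)) =
      contractLeft (toForm k H T) (w * (antipode k x ⊗ₜ[k] 1)) * ((g⁻¹ : GroupLike k H) : H) := by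
    intro w
    induction w with
    | zero => simp
    | add x y hx hy => simp only [map_add, add_mul, hx, hy]
    | tmul p q => simp
  have hgg : (g : H) * ((g⁻¹ : GroupLike k H) : H) = 1 := g.2.mul_antipode_cancel
  rw [hc, contractRight_comul_mul_antipode hT ht, ht.comul_mul_tmul_one,
    contractLeft_mul_one_tmul, contractLeft_comul_of_isLeftIntegral hg, hSg]
  simp only [smul_mul_assoc]
  rw [mul_assoc, mul_assoc _ (g : H), hgg, mul_one, ← mul_assoc, hgg, one_mul]

end Integrals
/-! ### Symmetric forms on comodule algebras -/

section SymmetricForm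
variable {k H A : Type*} [Field k] [Ring H] [HopfAlgebra k H] [Ring A] [Algebra k A]

/-- Under `A* ⊗ H ≃ Hom(A, H)`, colinearity of `x ↦ l(x ·)` compares `∑ l(x₀ b) x₁` with the value
`∑ l(x b₀) S(b₁)` of the dual coaction. This computes the first side. -/
theorem dualTensorHom_rTensor [Module.Finite k A] {l : Module.Dual k A}
    {θ : A ≃ₗ[k] Module.Dual k A} (hθ : ∀ x b, θ x b = l (x * b)) (w : A ⊗[k] H) (b : A) :
    dualTensorHomEquiv k A H (θ.toLinearMap.rTensor H w) b =
      contractLeft l (w * (b ⊗ₜ[k] 1)) := by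
  induction w with
  | zero => simp
  | add x y hx hy => simp only [map_add, LinearMap.add_apply, add_mul, hx, hy]
  | tmul p q => simp [hθ]

variable [RightComoduleAlgebra k H A]

/-- `l` is an `(H, u)`-symmetric form on the comodule algebra `A`: it is colinear, that is
`∑ l(b₀) b₁ = l(b) 1`, it satisfies `l(a b) = l(b (u⁻¹ · a))`, and it is nondegenerate. -/
structure IsSymmetricForm (u : H →ₐ[k] k) (l : Module.Dual k A) : Prop where
  colinear : ∀ b, contractLeft l (coaction k H A b) = l b • (1 : H)
  twisted : ∀ a b, l (a * b) = l (b * formAct (charInv u) a)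
  nondegenerate : ∀ a, (∀ b, l (a * b) = 0) → a = 0

/-- `∑ ρ(b₀) (1 ⊗ S(b₁)) = b ⊗ 1` for the coaction `ρ`. -/
theorem mul_map_coaction_antipode (b : A) :
    LinearMap.mul' k (A ⊗[k] H) (TensorProduct.map (coaction k H A)
      (TensorProduct.mk k A H 1 ∘ₗ antipode k) (coaction k H A b)) = b ⊗ₜ[k] 1 := by
  have h1 : ∀ w : A ⊗[k] H, LinearMap.mul' k (A ⊗[k] H) (TensorProduct.map (coaction k H A)
      (TensorProduct.mk k A H 1 ∘ₗ antipode k) w) =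
      (LinearMap.mul' k H ∘ₗ (antipode k).lTensor H).lTensor A (TensorProduct.assoc k A H H
        ((coaction k H A).rTensor H w)) := by
    intro w
    induction w with
    | zero => simp
    | add x y hx hy => simp only [map_add, hx, hy]
    | tmul p q =>
      simp only [TensorProduct.map_tmul, LinearMap.mul'_apply, LinearMap.rTensor_tmul,
        LinearMap.comp_apply, TensorProduct.mk_apply]
      generalize coaction k H A p = s
      induction s with
      | zero => simp
      | add x y hx hy => simp only [map_add, add_mul, add_tmul, hx, hy]
      | tmul c d => simp
  have h2 := LinearMap.congr_fun (RightComoduleAlgebra.coassoc (k := k) (H := H) (A := A)) b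
  have h3 := LinearMap.congr_fun (RightComoduleAlgebra.counit_coact (k := k) (H := H) (A := A)) b
  change TensorProduct.assoc k A H H ((coaction k H A).rTensor H (coaction k H A b)) =
    (comul (R := k)).lTensor A (coaction k H A b) at h2
  change TensorProduct.rid k A ((counit (R := k) (A := H)).lTensor A (coaction k H A b)) = b at h3
  rw [h1, h2, ← LinearMap.lTensor_comp_apply]
  conv_rhs => rw [← h3]
  generalize coaction k H A b = s
  induction s with
  | zero => simp
  | add x y hx hy => simp only [map_add, add_tmul, hx, hy]
  | tmul c d =>
    simp [mul_antipode_lTensor_comul_apply, Algebra.algebraMap_eq_smul_one, smul_tmul]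

theorem map_mul_coaction (a b : A) :
    coaction k H A (a * b) = coaction k H A a * coaction k H A b :=
  map_mul (RightComoduleAlgebra.coact (k := k) (H := H) (A := A)) a b

/-- For a colinear form `l`, `∑ l(x b₀) S(b₁) = ∑ l(x₀ b) x₁`. -/
theorem antipode_contractLeft_coaction {l : Module.Dual k A}
    (hl : ∀ b, contractLeft l (coaction k H A b) = l b • (1 : H)) (x b : A) :
    antipode k (contractLeft l ((x ⊗ₜ[k] 1) * coaction k H A b)) =
      contractLeft l (coaction k H A x * (b ⊗ₜ[k] 1)) := by
  rw [← mul_map_coaction_antipode (k := k) (H := H) b]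
  generalize coaction k H A b = w
  induction w with
  | zero => simp
  | add y z hy hz => simp only [map_add, mul_add, hy, hz]
  | tmul p q =>
    simp only [TensorProduct.map_tmul, LinearMap.mul'_apply, LinearMap.comp_apply,
      TensorProduct.mk_apply]
    rw [← mul_assoc, ← map_mul_coaction, contractLeft_mul_one_tmul, hl]
    simp

theorem dualTensorHom_dualCoaction [Module.Finite k A] {l : Module.Dual k A}
    {θ : A ≃ₗ[k] Module.Dual k A} (hθ : ∀ x b, θ x b = l (x * b)) (x b : A) :
    dualTensorHomEquiv k A H (dualCoaction k H A (θ x)) b =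
      antipode k (contractLeft l ((x ⊗ₜ[k] 1) * coaction k H A b)) := by
  have h : θ x = l ∘ₗ LinearMap.mulLeft k x := LinearMap.ext fun b => hθ x b
  rw [contractLeft_tmul_one_mul, ← h]
  simp [dualCoaction, contractLeft]

/-- An isomorphism `θ : A ≃ F(A*)` of bimodules in comodules is `x ↦ l(x ·)` for the symmetric form
`l = θ(1)`, and conversely. -/
theorem isSymmetric_iff [Module.Finite k A] (u : H →ₐ[k] k)
    (hS : Function.Injective (antipode k (A := H))) :
    IsSymmetric A u ↔ IsSovereign u ∧ ∃ l : Module.Dual k A, IsSymmetricForm u l := by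
  refine and_congr_right fun _ => ⟨?_, ?_⟩
  · rintro ⟨θ, h1, h2, h3⟩
    have hθ : ∀ x b, θ x b = θ 1 (x * b) := by
      intro x b
      have := LinearMap.congr_fun (h2 1 x) b
      rwa [one_mul] at this
    refine ⟨θ 1, fun b => hS ?_, fun a b => ?_, fun a ha => ?_⟩
    · have h4 := LinearMap.congr_fun (congrArg (dualTensorHomEquiv k A H) (h3 1)) b
      rw [dualTensorHom_dualCoaction hθ, dualTensorHom_rTensor hθ] at h4
      rw [show coaction k H A 1 = 1 from
        map_one (RightComoduleAlgebra.coact (k := k) (H := H) (A := A)),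
        ← Algebra.TensorProduct.one_def, one_mul, one_mul] at h4
      rw [h4]
      simp
    · rw [← hθ, ← mul_one a, h1, mul_one]
      rfl
    · apply θ.injective
      ext b
      rw [hθ, ha]
      simp
  · rintro ⟨l, hl⟩
    let θ₀ : A →ₗ[k] Module.Dual k A := (LinearMap.mul k A).compr₂ l
    have hinj : Function.Injective θ₀ := by
      rw [injective_iff_map_eq_zero]
      exact fun a ha => hl.nondegenerate a fun b => LinearMap.congr_fun ha b
    let θ : A ≃ₗ[k] Module.Dual k A := LinearEquiv.ofBijective θ₀
      ⟨hinj, (LinearMap.injective_iff_surjective_of_finrank_eq_finrank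
        (Subspace.dual_finrank_eq (K := k) (V := A)).symm).1 hinj⟩
    have hθ : ∀ x b, θ x b = l (x * b) := fun _ _ => rfl
    refine ⟨θ, fun a x => ?_, fun x a => ?_, fun x => ?_⟩
    · ext b
      change l (a * x * b) = l (x * (b * formAct (charInv u) a))
      rw [mul_assoc, hl.twisted, mul_assoc]
    · ext b
      change l (x * a * b) = l (x * (a * b))
      rw [mul_assoc]
    · apply (dualTensorHomEquiv k A H).injective
      ext b
      rw [dualTensorHom_dualCoaction hθ, dualTensorHom_rTensor hθ,
        antipode_contractLeft_coaction hl.colinear]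

theorem counit_contractLeft_mul_coaction (l : Module.Dual k A) (a b : A) :
    counit (R := k) (contractLeft l ((a ⊗ₜ[k] (1 : H)) * coaction k H A b)) = l (a * b) := by
  have h := LinearMap.congr_fun (RightComoduleAlgebra.counit_coact (k := k) (H := H) (A := A)) b
  change TensorProduct.rid k A ((counit (R := k) (A := H)).lTensor A (coaction k H A b)) = b at h
  conv_rhs => rw [← h]
  generalize coaction k H A b = w
  induction w with
  | zero => simp
  | add y z hy hz => simp only [map_add, mul_add, hy, hz]
  | tmul p q => simp [mul_comm]

/-- The two linear conditions on a symmetric form are together equivalent to the single identity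
`∑ l(a b₀) b₁ = S(∑ l(b a'₀) a'₁)` with `a' = u⁻¹ · a`. -/
theorem colinear_and_twisted_iff (u : H →ₐ[k] k) (l : Module.Dual k A) :
    ((∀ b, contractLeft l (coaction k H A b) = l b • (1 : H)) ∧
      ∀ a b, l (a * b) = l (b * formAct (charInv u) a)) ↔
    ∀ a b, contractLeft l ((a ⊗ₜ[k] 1) * coaction k H A b) =
      antipode k (contractLeft l ((b ⊗ₜ[k] 1) * coaction k H A (formAct (charInv u) a))) := by
  have hone : coaction k H A 1 = 1 :=
    map_one (RightComoduleAlgebra.coact (k := k) (H := H) (A := A))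
  constructor
  · rintro ⟨h1, h2⟩ a b
    rw [antipode_contractLeft_coaction h1]
    generalize coaction k H A b = w
    induction w with
    | zero => simp
    | add y z hy hz => simp only [map_add, mul_add, add_mul, hy, hz]
    | tmul p q => simp [h2 a p]
  · intro h
    refine ⟨fun b => ?_, fun a b => ?_⟩
    · have h1 : formAct (charInv u) (1 : A) = 1 := by
        simp [formAct, hone, Algebra.TensorProduct.one_def, charInv]
      have := h 1 b
      rw [h1, hone, ← Algebra.TensorProduct.one_def, one_mul, mul_one] at this
      simpa using this
    · have := congrArg (counit (R := k)) (h a b)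
      rwa [counit_antipode, counit_contractLeft_mul_coaction,
        counit_contractLeft_mul_coaction] at this

/-- Coassociativity: applying `β` to the second factor of `Δ(∑ l(b a₀) a₁)` amounts to replacing `a` by
`β · a`. -/
theorem contractRight_comul_contractLeft (l : Module.Dual k A) (β : H →ₗ[k] k) (a b : A) :
    contractRight β (comul (R := k) (contractLeft l ((b ⊗ₜ[k] 1) * coaction k H A a))) =
      contractLeft l ((b ⊗ₜ[k] 1) * coaction k H A (formAct β a)) := by
  have h2 := LinearMap.congr_fun (RightComoduleAlgebra.coassoc (k := k) (H := H) (A := A)) a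
  change TensorProduct.assoc k A H H ((coaction k H A).rTensor H (coaction k H A a)) =
    (comul (R := k)).lTensor A (coaction k H A a) at h2
  have hL : ∀ w : A ⊗[k] H, contractRight β (comul (R := k) (contractLeft l ((b ⊗ₜ[k] 1) * w))) =
      contractLeft (l ∘ₗ LinearMap.mulLeft k b)
        ((contractRight β).lTensor A ((comul (R := k)).lTensor A w)) := by
    intro w
    induction w with
    | zero => simp
    | add y z hy hz => simp only [map_add, mul_add, hy, hz]
    | tmul p q => simp
  have hR : ∀ w : A ⊗[k] H, contractLeft l ((b ⊗ₜ[k] 1) *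
      coaction k H A (TensorProduct.rid k A (β.lTensor A w))) =
      contractLeft (l ∘ₗ LinearMap.mulLeft k b) ((contractRight β).lTensor A
        (TensorProduct.assoc k A H H ((coaction k H A).rTensor H w))) := by
    intro w
    induction w with
    | zero => simp
    | add y z hy hz => simp only [map_add, mul_add, hy, hz]
    | tmul p q =>
      simp only [LinearMap.lTensor_tmul, TensorProduct.rid_tmul, map_smul, mul_smul_comm,
        LinearMap.rTensor_tmul]
      generalize coaction k H A p = s
      induction s with
      | zero => simp
      | add y z hy hz => simp only [map_add, mul_add, smul_add, add_tmul, hy, hz]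
      | tmul c d => simp [smul_smul]
  rw [hL, ← h2, ← hR]
  rfl

end SymmetricForm
/-! ### The dual Hopf algebra -/

section Dual
variable {k H : Type*} [Field k] [Ring H] [HopfAlgebra k H] [Module.Finite k H]

/-- `∑ f₂(y) f₁` is the left translate `x ↦ f(x y)`. -/
theorem contractRight_evalAt_comul_apply (f : HopfDual k H) (x y : H) :
    contractRight (evalAt k y) (comul (R := k) f) x = f (x * y) := by
  rw [← pairing_comul]
  generalize comul (R := k) f = r
  induction r with
  | zero => simp
  | add a b ha hb => simp_all
  | tmul a b => simp [mul_comm]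

theorem charInv_evalChar (g : GroupLike k H) :
    charInv (evalChar g) = evalAt k ((g⁻¹ : GroupLike k H) : H) := rfl

theorem antipode_hopfDual_apply (f : HopfDual k H) (x : H) :
    antipode k f x = f (antipode k x) := rfl

/-- Dually to `S²` being conjugation by `g` on `H`, evaluation at `g` is a sovereign character. -/
theorem isSovereign_evalChar {g : GroupLike k H}
    (hSg : ∀ h : H, antipode k (antipode k h) = ((g⁻¹ : GroupLike k H) : H) * h * (g : H)) :
    IsSovereign (evalChar g) := by
  intro f
  ext x
  rw [antipode_hopfDual_apply, antipode_hopfDual_apply, hSg, mul_assoc, ← pairing_comul]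
  simp only [sovereignConj, LinearMap.comp_apply, charInv_evalChar]
  generalize comul (R := k) f = r
  induction r with
  | zero => simp
  | add a b ha hb => simp only [map_add, LinearMap.add_apply, ha, hb]
  | tmul p q =>
    have := contractRight_evalAt_comul_apply q x (g : H)
    rw [pairing_tmul, ← this]
    simp only [LinearMap.lTensor_tmul, TensorProduct.map_tmul, LinearEquiv.coe_coe,
      TensorProduct.lid_tmul, map_smul, LinearMap.smul_apply, smul_eq_mul]
    rfl

/-- Pure tensors of linear forms separate the elements of `H ⊗ H`. -/
theorem eq_of_pairing_eq {w w' : H ⊗[k] H}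
    (h : ∀ f f' : HopfDual k H, pairing k H (f ⊗ₜ f') w = pairing k H (f ⊗ₜ f') w') :
    w = w' := by
  rw [← sub_eq_zero, ← Module.forall_dual_apply_eq_zero_iff k]
  intro φ
  obtain ⟨s, rfl⟩ := (pairing k H).surjective φ
  rw [map_sub, sub_eq_zero]
  induction s with
  | zero => simp
  | add a b ha hb => simp only [map_add, LinearMap.add_apply, ha, hb]
  | tmul f f' => exact h f f'

theorem pairing_eq_contractRight (f f' : HopfDual k H) (w : H ⊗[k] H) :
    pairing k H (f ⊗ₜ f') w = f (contractRight (toForm k H f') w) := by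
  induction w with
  | zero => simp
  | add a b ha hb => simp only [map_add, ha, hb]
  | tmul x y => simp [mul_comm]

end Dual

/-! ### Forms on the smash product -/

section Smash
variable {k H A : Type*} [Field k] [Ring H] [HopfAlgebra k H] [Ring A] [Algebra k A]

/-- The bilinear form `(a ⊗ f, b ⊗ h) ↦ l(a b) f(h)` on `(A ⊗ H*) × (A ⊗ H)`, as a linear form for a
fixed first argument. -/
def tensorForm (l : Module.Dual k A) (w : A ⊗[k] HopfDual k H) : A ⊗[k] H →ₗ[k] k :=
  TensorProduct.lift (LinearMap.mk₂ k (fun b h => l (contractRight (evalAt k h) w * b))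
    (fun b b' h => by simp [mul_add]) (fun c b h => by simp)
    (fun b h h' => by
      have : evalAt k (h + h') = evalAt k h + evalAt k h' := by ext; simp
      simp [this, contractRight, LinearMap.lTensor_add, add_mul])
    (fun c b h => by
      have : evalAt k (c • h) = c • evalAt k h := by ext; simp
      simp [this, contractRight, LinearMap.lTensor_smul]))

theorem tensorForm_tmul (l : Module.Dual k A) (w : A ⊗[k] HopfDual k H) (b : A) (h : H) :
    tensorForm l w (b ⊗ₜ h) = l (contractRight (evalAt k h) w * b) := rfl

variable [Module.Finite k H] [RightComoduleAlgebra k H A]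

/-- The linear form `a # f ↦ l(a) f(t)` on the smash product. -/
def smashForm (l : Module.Dual k A) (t : H) : Module.Dual k (SmashProduct k H A) :=
  contractLeft l ∘ₗ (evalAt k t).lTensor A ∘ₗ (toTensor k H A).toLinearMap

theorem smashForm_tmul (l : Module.Dual k A) (t : H) (a : A) (f : HopfDual k H) :
    smashForm l t ((toTensor k H A).symm (a ⊗ₜ f)) = l a * f t := by
  simp [smashForm]

/-- The value on `(a # f)(b # f')` is `∑ f(e t₁) f'(t₂)` with `e = ∑ l(a b₀) b₁`. -/
theorem smashForm_mul (l : Module.Dual k A) (t : H) (a b : A) (f f' : HopfDual k H) :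
    smashForm l t ((toTensor k H A).symm (a ⊗ₜ f) * (toTensor k H A).symm (b ⊗ₜ f')) =
      pairing k H (f ⊗ₜ f')
        ((contractLeft l ((a ⊗ₜ[k] 1) * coaction k H A b) ⊗ₜ[k] 1) * comul (R := k) t) := by
  have h : (toTensor k H A).symm (a ⊗ₜ f) * (toTensor k H A).symm (b ⊗ₜ f') =
      (toTensor k H A).symm (TensorProduct.map (LinearMap.mulLeft k a)
        (LinearMap.mulRight k f' ∘ₗ translate f) (coaction k H A b)) := by
    rw [← smashMul_tmul]; rfl
  rw [h]
  generalize coaction k H A b = w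
  induction w with
  | zero => simp
  | add y z hy hz => simp only [map_add, mul_add, add_mul, add_tmul, hy, hz]
  | tmul p q =>
    simp only [TensorProduct.map_tmul, smashForm_tmul, LinearMap.comp_apply,
      LinearMap.mulRight_apply, LinearMap.mulLeft_apply, hopfDual_mul_apply]
    generalize comul (R := k) t = s
    induction s with
    | zero => simp
    | add y z hy hz => simp only [map_add, mul_add, hy, hz]
    | tmul c d => simp [← smul_tmul']

theorem coaction_smash_tmul (a : A) (f : HopfDual k H) :
    coaction k (HopfDual k H) (SmashProduct k H A) ((toTensor k H A).symm (a ⊗ₜ f)) =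
      ((toTensor k H A).symm.toLinearMap ∘ₗ TensorProduct.mk k A _ a).rTensor _
        (comul (R := k) f) := smashCoact_tmul a f

theorem formAct_smash_tmul (y : H) (a : A) (f : HopfDual k H) :
    formAct (evalAt k y) ((toTensor k H A).symm (a ⊗ₜ f)) =
      (toTensor k H A).symm (a ⊗ₜ contractRight (evalAt k y) (comul (R := k) f)) := by
  rw [formAct, LinearMap.comp_apply, LinearMap.comp_apply, coaction_smash_tmul]
  generalize comul (R := k) f = w
  induction w with
  | zero => simp
  | add y z hy hz => simp only [map_add, tmul_add, hy, hz]
  | tmul p q => simp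

theorem contractLeft_coaction_smash_apply (L : Module.Dual k (SmashProduct k H A)) {a : A} {p : H}
    (hp : ∀ f, L ((toTensor k H A).symm (a ⊗ₜ f)) = f p) (f : HopfDual k H) (x : H) :
    (contractLeft L (coaction k (HopfDual k H) (SmashProduct k H A)
      ((toTensor k H A).symm (a ⊗ₜ f)))) x = f (p * x) := by
  rw [coaction_smash_tmul, ← pairing_comul]
  generalize comul (R := k) f = w
  induction w with
  | zero => simp
  | add y z hy hz => simp_all
  | tmul c d => simp [hp]

theorem smashForm_colinear (l : Module.Dual k A) {t : H} (ht : IsRightIntegral k t)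
    (z : SmashProduct k H A) :
    contractLeft (smashForm l t) (coaction k (HopfDual k H) (SmashProduct k H A) z) =
      smashForm l t z • (1 : HopfDual k H) := by
  obtain ⟨z, rfl⟩ := (toTensor k H A).symm.surjective z
  induction z with
  | zero => simp
  | add y z hy hz => simp only [map_add, add_smul, hy, hz]
  | tmul a f =>
    ext x
    rw [contractLeft_coaction_smash_apply (p := l a • t) _
      (fun f => by rw [smashForm_tmul, map_smul, smul_eq_mul]),
      smul_mul_assoc, ht, smashForm_tmul]
    simp only [map_smul, LinearMap.smul_apply, smul_eq_mul,
      hopfDual_one_apply]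
    ring

/-- A colinear form on `A # H*` sends `a # f` to `f(p)` for a right integral `p` depending on `a`,
so uniqueness of integrals splits it as `l(a) f(t)`. -/
theorem exists_eq_smashForm {T : HopfDual k H} (hT : IsLeftIntegral k T) (h0 : T ≠ 0)
    (hsurj : Function.Surjective (antipode k (A := H))) {t : H} (ht : IsRightIntegral k t)
    (hTt : T t = 1) (L : Module.Dual k (SmashProduct k H A))
    (hL : ∀ z, contractLeft L (coaction k (HopfDual k H) (SmashProduct k H A) z) =
      L z • (1 : HopfDual k H)) :
    ∃ l : Module.Dual k A, L = smashForm l t := by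
  refine ⟨L ∘ₗ (toTensor k H A).symm.toLinearMap ∘ₗ (TensorProduct.mk k A _).flip T, ?_⟩
  suffices h : ∀ a f, L ((toTensor k H A).symm (a ⊗ₜ f)) =
      L ((toTensor k H A).symm (a ⊗ₜ T)) * f t by
    refine LinearMap.ext fun z => ?_
    obtain ⟨z, rfl⟩ := (toTensor k H A).symm.surjective z
    induction z with
    | zero => simp
    | add y z hy hz => simp only [map_add, hy, hz]
    | tmul a f =>
      rw [smashForm_tmul, h]
      rfl
  intro a
  obtain ⟨p, hp⟩ := (Module.evalEquiv k H).surjective (L ∘ₗ (toTensor k H A).symm.toLinearMap ∘ₗ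
    TensorProduct.mk k A _ a ∘ₗ (toForm k H).symm.toLinearMap)
  have hp' : ∀ f, L ((toTensor k H A).symm (a ⊗ₜ f)) = f p := fun f =>
    (LinearMap.congr_fun hp (toForm k H f)).symm
  have hpr : IsRightIntegral k p := by
    intro x
    rw [← sub_eq_zero, ← Module.forall_dual_apply_eq_zero_iff k]
    intro φ
    have h1 := congrArg (fun f : HopfDual k H => f x)
      (hL ((toTensor k H A).symm (a ⊗ₜ (toForm k H).symm φ)))
    simp only [contractLeft_coaction_smash_apply L hp', hp'] at h1
    rw [map_sub, sub_eq_zero, map_smul]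
    refine h1.trans ?_
    simp [mul_comm]
  intro f
  rw [hp', hp']
  conv_lhs => rw [ht.eq_smul hT h0 hsurj hTt hpr, map_smul, smul_eq_mul]

/-- When `∑ f'(t₂) t₁ = h`, pairing with `b # f'` is pairing with `∑ b₀ ⊗ b₁ h`. -/
theorem smashForm_mul_eq_tensorForm (l : Module.Dual k A) {t : H} {f' : HopfDual k H} {h : H}
    (hf' : contractRight (toForm k H f') (comul (R := k) t) = h) (w : A ⊗[k] HopfDual k H)
    (b : A) :
    smashForm l t ((toTensor k H A).symm w * (toTensor k H A).symm (b ⊗ₜ f')) =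
      tensorForm l w (coaction k H A b * (1 ⊗ₜ[k] h)) := by
  induction w with
  | zero =>
    generalize coaction k H A b * (1 ⊗ₜ[k] h) = s
    induction s with
    | zero => simp
    | add y z hy hz => rw [map_add, ← hy, ← hz]; simp
    | tmul c d => simp [tensorForm_tmul]
  | add y z hy hz =>
    rw [map_add, add_mul, map_add, hy, hz]
    generalize coaction k H A b * (1 ⊗ₜ[k] h) = s
    induction s with
    | zero => simp
    | add y z hy hz => simp only [map_add, ← hy, ← hz]; abel
    | tmul c d => simp [tensorForm_tmul, add_mul]
  | tmul a f =>
    rw [smashForm_mul, pairing_eq_contractRight, contractRight_tmul_one_mul, hf']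
    generalize coaction k H A b = s
    induction s with
    | zero => simp
    | add y z hy hz => simp only [map_add, mul_add, add_mul, hy, hz]
    | tmul c d => simp [tensorForm_tmul, mul_comm]

/-- Since `Δ(t)` is a Casimir element, every `h` has the form `∑ f'(t₂) t₁`. Nondegeneracy of `l(a) f(t)`
thus concerns the forms `∑ l(a b₀) f(b₁ h)`, and `b ⊗ h ↦ ∑ b₀ ⊗ b₁ h` is onto. -/
theorem smashForm_nondegenerate_iff {T : HopfDual k H} (hT : IsLeftIntegral k T)
    {t : H} (ht : IsRightIntegral k t)
    (hTt : T t = 1) (l : Module.Dual k A) :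
    (∀ x, (∀ y, smashForm l t (x * y) = 0) → x = 0) ↔
      ∀ a, (∀ b, l (a * b) = 0) → a = 0 := by
  constructor
  · intro h a ha
    have h1 : (toTensor k H A).symm (a ⊗ₜ 1) = 0 := by
      apply h
      intro y
      obtain ⟨y, rfl⟩ := (toTensor k H A).symm.surjective y
      induction y with
      | zero => simp
      | add y z hy hz => simp only [map_add, mul_add, hy, hz, add_zero]
      | tmul b f =>
        rw [smashForm_mul, pairing_eq_contractRight, contractRight_tmul_one_mul,
          hopfDual_one_apply, Bialgebra.counit_mul, counit_contractLeft_mul_coaction, ha, zero_mul]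
    have h2 := congrArg (contractRight (evalAt k 1)) ((LinearEquiv.map_eq_zero_iff _).1 h1)
    simpa using h2
  · intro h x hx
    obtain ⟨w, rfl⟩ := (toTensor k H A).symm.surjective x
    have h1 : ∀ b h, tensorForm l w (coaction k H A b * (1 ⊗ₜ[k] h)) = 0 := by
      intro b h
      -- `f' = T(· S(h))` satisfies `∑ f'(t₂) t₁ = h`
      rw [← smashForm_mul_eq_tensorForm l (f' := (toForm k H).symm
        (toForm k H T ∘ₗ LinearMap.mulRight k (antipode k h))) ?_, hx]
      rw [LinearEquiv.apply_symm_apply, ← contractRight_mul_one_tmul,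
        contractRight_comul_mul_antipode hT ht, hTt, one_smul]
    have h2 : ∀ b h, tensorForm l w (b ⊗ₜ[k] h) = 0 := by
      intro b h
      have : b ⊗ₜ[k] h = (b ⊗ₜ[k] 1) * (1 ⊗ₜ[k] h) := by simp
      rw [this, ← mul_map_coaction_antipode (k := k) (H := H) b]
      generalize coaction k H A b = s
      induction s with
      | zero => simp
      | add y z hy hz => simp only [map_add, add_mul, hy, hz, add_zero]
      | tmul c d =>
        rw [TensorProduct.map_tmul, LinearMap.mul'_apply, LinearMap.comp_apply,
          TensorProduct.mk_apply, mul_assoc, Algebra.TensorProduct.tmul_mul_tmul, one_mul, h1]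
    rw [LinearEquiv.map_eq_zero_iff]
    refine ext_right fun y => ?_
    refine (h (contractRight (evalAt k y) w) fun b => h2 b y).trans ?_
    simp

/-- Moving `g⁻¹` across the coproduct of `t` turns the twisted trace identity for `l(a) f(t)` into
an identity in `H`. -/
theorem smashForm_twisted_iff {T : HopfDual k H} (hT : IsLeftIntegral k T) (h0 : T ≠ 0)
    (hsurj : Function.Surjective (antipode k (A := H))) {g : GroupLike k H}
    (hg : IsDistinguishedGroupLike g)
    (hSg : ∀ h : H, antipode k (antipode k h) = ((g⁻¹ : GroupLike k H) : H) * h * (g : H))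
    {t : H} (ht : IsRightIntegral k t) (hTt : T t = 1) {α : H →ₐ[k] k}
    (hα : ∀ h, h * t = charInv α h • t) (l : Module.Dual k A) :
    (∀ x y, smashForm l t (x * y) = smashForm l t (y * formAct (charInv (evalChar g)) x)) ↔
    ∀ a b : A, contractLeft l ((a ⊗ₜ[k] 1) * coaction k H A b) =
      antipode k (contractLeft l ((b ⊗ₜ[k] 1) * coaction k H A (formAct (charInv α) a))) := by
  have hflip : ∀ (f f' : HopfDual k H) (w : H ⊗[k] H),
      pairing k H (f' ⊗ₜ contractRight (evalAt k ((g⁻¹ : GroupLike k H) : H)) (comul (R := k) f)) w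
      = pairing k H (f ⊗ₜ f') (TensorProduct.comm k H H w *
        (((g⁻¹ : GroupLike k H) : H) ⊗ₜ[k] 1)) := by
    intro f f' w
    induction w with
    | zero => simp
    | add y z hy hz => simp only [map_add, add_mul, hy, hz]
    | tmul c d =>
      rw [pairing_tmul, contractRight_evalAt_comul_apply, TensorProduct.comm_tmul,
        Algebra.TensorProduct.tmul_mul_tmul, pairing_tmul, mul_one, mul_comm]
  have hcomm : ∀ (e : H) (w : H ⊗[k] H), TensorProduct.comm k H H ((e ⊗ₜ[k] 1) * w) =
      (1 ⊗ₜ[k] e) * TensorProduct.comm k H H w := by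
    intro e w
    induction w with
    | zero => simp
    | add y z hy hz => simp only [map_add, mul_add, hy, hz]
    | tmul c d => simp
  have hright : ∀ (a b : A) (f f' : HopfDual k H), smashForm l t
      ((toTensor k H A).symm (b ⊗ₜ f') *
        formAct (charInv (evalChar g)) ((toTensor k H A).symm (a ⊗ₜ f))) =
      pairing k H (f ⊗ₜ f') ((antipode k (contractLeft l ((b ⊗ₜ[k] 1) *
        coaction k H A (formAct (charInv α) a))) ⊗ₜ[k] 1) * comul (R := k) t) := by
    intro a b f f'
    rw [charInv_evalChar, formAct_smash_tmul, smashForm_mul, hflip, hcomm, mul_assoc,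
      ← comul_eq_comm_comul_mul hT h0 hsurj (hg T hT) hSg ht, one_tmul_mul_comul hα,
      contractRight_comul_contractLeft]
  constructor
  · intro h a b
    have h1 : (contractLeft l ((a ⊗ₜ[k] 1) * coaction k H A b) ⊗ₜ[k] 1) * comul (R := k) t =
        (antipode k (contractLeft l ((b ⊗ₜ[k] 1) * coaction k H A (formAct (charInv α) a))) ⊗ₜ[k] 1)
          * comul (R := k) t := eq_of_pairing_eq fun f f' => by
      have := h ((toTensor k H A).symm (a ⊗ₜ f)) ((toTensor k H A).symm (b ⊗ₜ f'))
      rwa [hright, smashForm_mul] at this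
    -- contracting the second leg with `T` turns `Δ(t)` into `1`
    have h2 := congrArg (contractRight (toForm k H T)) h1
    simpa only [contractRight_tmul_one_mul, contractRight_comul_of_isLeftIntegral hT, hTt,
      one_smul, mul_one] using h2
  · intro h x y
    obtain ⟨x, rfl⟩ := (toTensor k H A).symm.surjective x
    obtain ⟨y, rfl⟩ := (toTensor k H A).symm.surjective y
    induction x with
    | zero => simp
    | add x x' hx hx' => simp only [map_add, add_mul, mul_add, hx, hx']
    | tmul a f =>
      induction y with
      | zero => simp
      | add y y' hy hy' => simp only [map_add, add_mul, mul_add, hy, hy']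
      | tmul b f' => rw [hright, smashForm_mul, h]

end Smash
end HopfSmash
end

theorem theorem4p1 {k : Type*} {H : Type*} {A : Type*} [Field k] [Ring H] [HopfAlgebra k H]
    [Module.Finite k H] (g : GroupLike k H) (α : H →ₐ[k] k)
    (hg : HopfSmash.IsDistinguishedGroupLike g)
    (hα : HopfSmash.IsDistinguishedCharacter α)
    (hSg : ∀ h : H, HopfAlgebra.antipode k (HopfAlgebra.antipode k h) =
      ((g⁻¹ : GroupLike k H) : H) * h * (g : H))
    (hSα : ∀ h : H, HopfAlgebra.antipode k (HopfAlgebra.antipode k h) =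
      HopfSmash.sovereignConj α h)
    [Ring A] [Algebra k A] [Module.Finite k A] [HopfSmash.RightComoduleAlgebra k H A] :
    HopfSmash.IsSymmetric A α ↔
      HopfSmash.IsSymmetric (HopfSmash.SmashProduct k H A) (HopfSmash.evalChar g) := by
  open HopfSmash HopfAlgebra in
  have hgg : (g : H) * ((g⁻¹ : GroupLike k H) : H) = 1 := g.2.mul_antipode_cancel
  have hinj : Function.Injective (antipode k (A := H)) := by
    rw [injective_iff_map_eq_zero]
    intro x hx
    have h1 := hSg x
    rw [hx, map_zero] at h1
    calc x = (g : H) * (((g⁻¹ : GroupLike k H) : H) * x * (g : H)) *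
          ((g⁻¹ : GroupLike k H) : H) := by
          rw [mul_assoc, mul_assoc _ (g : H), hgg, mul_one, ← mul_assoc, hgg, one_mul]
      _ = 0 := by rw [← h1, mul_zero, zero_mul]
  have hsurj : Function.Surjective (antipode k (A := H)) :=
    LinearMap.injective_iff_surjective.1 hinj
  have hinj' : Function.Injective (antipode k (A := HopfDual k H)) := by
    intro f f' h
    ext x
    obtain ⟨y, rfl⟩ := hsurj x
    exact congrArg (fun f : HopfDual k H => f y) h
  have : Module.Finite k (HopfDual k H) := Module.Finite.equiv (toForm k H).symm
  obtain ⟨T, h0, hT⟩ := exists_isLeftIntegral_ne_zero (k := k) (K := HopfDual k H)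
  obtain ⟨t, ht, hTt⟩ := exists_isRightIntegral hT h0
  have hαt := mul_eq_of_isRightIntegral ht hα hinj hsurj
  rw [isSymmetric_iff α hinj, isSymmetric_iff (evalChar g) hinj',
    and_iff_right (show IsSovereign α from hSα), and_iff_right (isSovereign_evalChar hSg)]
  have key : ∀ l : Module.Dual k A,
      IsSymmetricForm α l ↔ IsSymmetricForm (evalChar g) (smashForm (H := H) l t) := fun l =>
    have h1 := smashForm_twisted_iff hT h0 hsurj hg hSg ht hTt hαt l
    have h2 := colinear_and_twisted_iff α l
    have h3 := smashForm_nondegenerate_iff hT ht hTt l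
    ⟨fun h => ⟨smashForm_colinear l ht, h1.2 (h2.1 ⟨h.1, h.2⟩), h3.2 h.3⟩,
      fun h => ⟨(h2.2 (h1.1 h.2)).1, (h2.2 (h1.1 h.2)).2, h3.1 h.3⟩⟩
  constructor
  · rintro ⟨l, hl⟩
    exact ⟨_, (key l).1 hl⟩
  · rintro ⟨L, hL⟩
    obtain ⟨l, rfl⟩ := exists_eq_smashForm hT h0 hsurj ht hTt L hL.colinear
    exact ⟨l, (key l).2 hL⟩
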